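/- Let $U$ and $W$ be finite-dimensional real normed spaces, let $U\otimes U$ carry a norm, and write $|\cdot|$ for all norms. For a path $m$ put $m_{s,t}=m_t-m_s$; for a path or a two-parameter function $m$ on an interval $I$ put $\|m\|_{\gamma;I}=\sup_{s,t\in I,\,s\ne t}|m_{s,t}|/|t-s|^{\gamma}$. Fix a delay $r>0$ and exponents $\frac13<\beta<\gamma\le\frac12$. A *delayed $\gamma$-rough path* $\mathbf X=(X,\mathbb X,\mathbb X(-r))$ consists of a locally $\gamma$-Hölder path $X:\mathbb R\to U$ and continuous maps $\mathbb X,\mathbb X(-r):\mathbb R\times\mathbb R\to U\otimes U$ such that, for all $s,u,t\in\mathbb R$, $$\mathbb X_{s,t}=\mathbb X_{s,u}+\mathbb X_{u,t}+X_{s,u}\otimes X_{u,t},\qquad \mathbb X_{s,t}(-r)=\mathbb X_{s,u}(-r)+\mathbb X_{u,t}(-r)+X_{s-r,u-r}\otimes X_{u,t},$$ and $\|\mathbb X\|_{2\gamma;I},\|\mathbb X(-r)\|_{2\gamma;I}<\infty$ for every compact interval $I$. Put $$\|\mathbf X\|_{\gamma;[a,b]}=\|X\|_{\gamma;[a,b]}+\|X\|_{\gamma;[a-r,b-r]}+\sqrt{\|\mathbb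 X\|_{2\gamma;[a,b]}}+\sqrt{\|\mathbb X(-r)\|_{2\gamma;[a,b]}}.$$ For an exponent $\alpha\le\gamma$, the space $\mathscr D_X^{\alpha}([a,b],W)$ of *controlled paths* consists of the pairs $(m,m')$ of paths $m:[a,b]\to W$ and $m':[a,b]\to L(U,W)$ for which, with $m^{\#}_{s,t}:=m_{s,t}-m'_sX_{s,t}$, the norm $$\|m\|_{\mathscr D_X^{\alpha}([a,b])}=|m_a|+|m'_a|+\|m'\|_{\alpha;[a,b]}+\|m^{\#}\|_{2\alpha;[a,b]}$$ is finite. Let $\sigma\in C^3_b(W^2,L(U,W))$, i.e. $\sigma$ is bounded and three times continuously differentiable with bounded derivatives, and write $\sigma_x,\sigma_y$ for its partial derivatives in the first and the second variable. Consider, for $(\xi,\xi')\in\mathscr D_X^{\beta}([-r,0],W)$, the rough delay equation $$y_t=\xi_0+\int_0^t\sigma(y_s,y_{s-r})\,d\mathbf X_s\quad(t\in[0,r]),\qquad y_t=\xi_t\quad(t\in[-r,0]).$$ A solution in $\mathscr D_X^{\alpha}$ is a path $y$ on $[-r,r]$ that satisfies these equations, such that $(y,y')\in\mathscr D_X^{\alpha}([0,r],W)$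 with $y'_t=\sigma(y_t,y_{t-r})$ for $t\in[0,r]$. Here the integral over $[0,t]$ is the limit, as the mesh of the partition $0=\tau_0\le\dots\le\tau_n=t$ tends to $0$, of $$\sum_{i<n}\Big[\sigma(y_{\tau_i},y_{\tau_i-r})X_{\tau_i,\tau_{i+1}}+\sigma_x(y_{\tau_i},y_{\tau_i-r})\,y'_{\tau_i}\,\mathbb X_{\tau_i,\tau_{i+1}}+\sigma_y(y_{\tau_i},y_{\tau_i-r})\,\xi'_{\tau_i-r}\,\mathbb X_{\tau_i,\tau_{i+1}}(-r)\Big].$$ **Theorem.** There exists a polynomial $P:\mathbb R\times\mathbb R\to\mathbb R$, whose coefficients depend only on $\sigma$, $\beta$, $\gamma$ (and on the fixed data $r$, $U$, $W$ and their norms), such that the following holds for every delayed $\gamma$-rough path $\mathbf X$, every $(\xi,\xi')\in\mathscr D_X^{\beta}([-r,0],W)$ and every $\alpha\in(\frac13,\beta]$. If $y^{\xi}$ is the solution of the equation with initial condition $\xi$ in $\mathscr D_X^{\alpha}$, then $y^{\xi}\in\mathscr D_X^{\beta}([0,r],W)$ and $$\|y^{\xi}\|_{\mathscr D_X^{\beta}([0,r])}\le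 P\big(A,\|\xi\|_{\mathscr D_X^{\beta}([-r,0])}\big),\qquad A=1+\|\mathbf X\|_{\gamma;[0,r]}.$$ -/

import Mathlib

open Filter Set
open scoped TensorProduct Topology

noncomputable section

/-- The quotients `q(s,t) / |t - s|^α`, for `s ≠ t` in `I`. Here `q(s,t)` is the size of a
two-parameter function at `(s,t)`, in the case of a path `m` the number `|m_t - m_s|`. -/
def holderQuotients (α : ℝ) (I : Set ℝ) (q : ℝ → ℝ → ℝ) : Set ℝ :=
  {c | ∃ s ∈ I, ∃ t ∈ I, s ≠ t ∧ c = q s t / |t - s| ^ α}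

/-- Finiteness of the `α`-Hölder seminorm on `I`. -/
def HolderFinite (α : ℝ) (I : Set ℝ) (q : ℝ → ℝ → ℝ) : Prop :=
  BddAbove (holderQuotients α I q)

/-- The `α`-Hölder seminorm on `I` (meaningful when `HolderFinite α I q`). -/
def holderSeminorm (α : ℝ) (I : Set ℝ) (q : ℝ → ℝ → ℝ) : ℝ :=
  sSup (holderQuotients α I q)

/-- The size of the increments of a path. -/
def incr {E : Type*} [NormedAddCommGroup E] (m : ℝ → E) (s t : ℝ) : ℝ := ‖m t - m s‖

section Definitions

variable {U W : Type*} [NormedAddCommGroup U] [NormedSpace ℝ U]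
  [NormedAddCommGroup W] [NormedSpace ℝ W]

/-- A delayed `γ`-rough path `(X, 𝕏, 𝕏(-r))` over `U` with delay `r`: a locally `γ`-Hölder path
with a Lévy area and a delayed Lévy area. The size of elements of `U ⊗ U` is measured by `N`. -/
structure DelayedRoughPath (N : Seminorm ℝ (U ⊗[ℝ] U)) (r γ : ℝ) where
  /-- the path `X` -/
  path : ℝ → U
  /-- the Lévy area `𝕏` -/
  area : ℝ → ℝ → U ⊗[ℝ] U
  /-- the delayed Lévy area `𝕏(-r)` -/
  delayedArea : ℝ → ℝ → U ⊗[ℝ] U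
  path_holder : ∀ a b : ℝ, HolderFinite γ (Icc a b) (incr path)
  area_continuous : ∀ s t : ℝ,
    Tendsto (fun p : ℝ × ℝ => N (area p.1 p.2 - area s t)) (𝓝 (s, t)) (𝓝 0)
  area_chen : ∀ s u t : ℝ,
    area s t = area s u + area u t + (path u - path s) ⊗ₜ[ℝ] (path t - path u)
  area_holder : ∀ a b : ℝ, HolderFinite (2 * γ) (Icc a b) (fun s t => N (area s t))
  delayedArea_continuous : ∀ s t : ℝ,
    Tendsto (fun p : ℝ × ℝ => N (delayedArea p.1 p.2 - delayedArea s t)) (𝓝 (s, t)) (𝓝 0)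
  delayedArea_chen : ∀ s u t : ℝ,
    delayedArea s t = delayedArea s u + delayedArea u t
      + (path (u - r) - path (s - r)) ⊗ₜ[ℝ] (path t - path u)
  delayedArea_holder : ∀ a b : ℝ,
    HolderFinite (2 * γ) (Icc a b) (fun s t => N (delayedArea s t))

/-- `‖𝓧‖_{γ;[a,b]}`. -/
def DelayedRoughPath.norm {N : Seminorm ℝ (U ⊗[ℝ] U)} {r γ : ℝ} (𝓧 : DelayedRoughPath N r γ)
    (a b : ℝ) : ℝ :=
  holderSeminorm γ (Icc a b) (incr 𝓧.path)
    + holderSeminorm γ (Icc (a - r) (b - r)) (incr 𝓧.path)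
    + √(holderSeminorm (2 * γ) (Icc a b) (fun s t => N (𝓧.area s t)))
    + √(holderSeminorm (2 * γ) (Icc a b) (fun s t => N (𝓧.delayedArea s t)))

/-- The remainder `m^#_{s,t} = m_{s,t} - m'_s X_{s,t}`. -/
def remainder (X : ℝ → U) (m : ℝ → W) (m' : ℝ → U →L[ℝ] W) (s t : ℝ) : W :=
  m t - m s - m' s (X t - X s)

/-- `(m, m')` belongs to the space `𝒟_X^β([a,b], W)` of controlled paths. Only the values of
`m` and `m'` on `[a,b]` matter. -/
structure IsControlled (X : ℝ → U) (β a b : ℝ) (m : ℝ → W) (m' : ℝ → U →L[ℝ] W) : Prop where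
  deriv_holder : HolderFinite β (Icc a b) (incr m')
  remainder_holder : HolderFinite (2 * β) (Icc a b) (fun s t => ‖remainder X m m' s t‖)

/-- The norm of `𝒟_X^β([a,b], W)`. -/
def controlledNorm (X : ℝ → U) (β a b : ℝ) (m : ℝ → W) (m' : ℝ → U →L[ℝ] W) : ℝ :=
  ‖m a‖ + ‖m' a‖ + holderSeminorm β (Icc a b) (incr m')
    + holderSeminorm (2 * β) (Icc a b) (fun s t => ‖remainder X m m' s t‖)

/-- `A ∈ L(U, L(U, W))` applied to a tensor, by `A (u ⊗ v) = (A u) v`. -/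
def applyTensor (A : U →L[ℝ] U →L[ℝ] W) : U ⊗[ℝ] U →ₗ[ℝ] W :=
  TensorProduct.lift A.toLinearMap₁₂

/-- `∫_a^b m d𝓧 = J` for a path `m` in `L(U, W)` with the decomposition
`m_{s,t} = ζ⁰_s X_{s,t} + ζ¹_s X_{s-r,t-r} + m^#_{s,t}`: the compensated Riemann sums
`∑ m_{τ_i} X_{τ_i,τ_{i+1}} + ζ⁰_{τ_i} 𝕏_{τ_i,τ_{i+1}} + ζ¹_{τ_i} 𝕏_{τ_i,τ_{i+1}}(-r)`
over partitions `a = τ_0 ≤ ⋯ ≤ τ_n = b` converge to `J` as the mesh tends to zero. -/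
def HasRoughIntegral {N : Seminorm ℝ (U ⊗[ℝ] U)} {r γ : ℝ} (𝓧 : DelayedRoughPath N r γ)
    (m : ℝ → U →L[ℝ] W) (ζ₀ ζ₁ : ℝ → U →L[ℝ] U →L[ℝ] W) (a b : ℝ) (J : W) : Prop :=
  ∀ ε > 0, ∃ δ > 0, ∀ (n : ℕ) (τ : ℕ → ℝ), Monotone τ → τ 0 = a → τ n = b →
    (∀ i < n, τ (i + 1) - τ i < δ) →
    ‖∑ i ∈ Finset.range n,
        (m (τ i) (𝓧.path (τ (i + 1)) - 𝓧.path (τ i))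
          + applyTensor (ζ₀ (τ i)) (𝓧.area (τ i) (τ (i + 1)))
          + applyTensor (ζ₁ (τ i)) (𝓧.delayedArea (τ i) (τ (i + 1)))) - J‖ < ε

/-- The partial derivative `σ_x` of `σ(x, y)`. -/
def partialX {F : Type*} [NormedAddCommGroup F] [NormedSpace ℝ F] (σ : W × W → F) (p : W × W) :
    W →L[ℝ] F :=
  (fderiv ℝ σ p).comp (ContinuousLinearMap.inl ℝ W W)

/-- The partial derivative `σ_y` of `σ(x, y)`. -/
def partialY {F : Type*} [NormedAddCommGroup F] [NormedSpace ℝ F] (σ : W × W → F) (p : W × W) :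
    W →L[ℝ] F :=
  (fderiv ℝ σ p).comp (ContinuousLinearMap.inr ℝ W W)

/-- `σ ∈ C^n_b`: bounded and `n` times continuously differentiable with bounded derivatives. -/
def IsCb {E F : Type*} [NormedAddCommGroup E] [NormedSpace ℝ E]
    [NormedAddCommGroup F] [NormedSpace ℝ F] (n : ℕ) (σ : E → F) : Prop :=
  ContDiff ℝ n σ ∧ ∀ k ≤ n, ∃ C : ℝ, ∀ p, ‖iteratedFDeriv ℝ k σ p‖ ≤ C

/-- `y`, with Gubinelli derivative `y'` on `[0,r]`, is a solution in `𝒟_X^α([0,r], W)` of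
`y_t = ξ_0 + ∫_0^t σ(y_s, y_{s-r}) d𝓧_s` for `t ∈ [0,r]`, `y_t = ξ_t` for `t ∈ [-r,0]`, where
the initial path `ξ` has the Gubinelli derivative `ξ'`. The integrand is the delayed controlled
path with `ζ⁰_s = σ_x(y_s, y_{s-r}) y'_s` and `ζ¹_s = σ_y(y_s, y_{s-r}) ξ'_{s-r}`. -/
structure IsSolution {N : Seminorm ℝ (U ⊗[ℝ] U)} {r γ : ℝ} (𝓧 : DelayedRoughPath N r γ)
    (σ : W × W → U →L[ℝ] W) (α : ℝ) (ξ : ℝ → W) (ξ' : ℝ → U →L[ℝ] W)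
    (y : ℝ → W) (y' : ℝ → U →L[ℝ] W) : Prop where
  initial : ∀ t ∈ Icc (-r) 0, y t = ξ t
  controlled : IsControlled 𝓧.path α 0 r y y'
  deriv_eq : ∀ t ∈ Icc 0 r, y' t = σ (y t, y (t - r))
  integral_eq : ∀ t ∈ Icc 0 r,
    HasRoughIntegral 𝓧 (fun s => σ (y s, y (s - r)))
      (fun s => (partialX σ (y s, y (s - r))).comp (y' s))
      (fun s => (partialY σ (y s, y (s - r))).comp (ξ' (s - r)))
      0 t (y t - ξ 0)

end Definitions

end

/-!
The integral in the equation is the limit of Riemann sums of a germ `Ξ`, whose defect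
`Ξ_{s,t} - Ξ_{s,u} - Ξ_{u,t}` is of order `|t - s| ^ (3κ)` when the solution and all data are
controlled with exponent `κ > 1/3`. As the integral is known to exist, comparison along dyadic
partitions yields the sewing estimate `|y_{s,t} - Ξ_{s,t}| ≤ C |t - s| ^ (3κ)`
(`norm_integral_sub_germ_le`), and with it a bound on the remainder `y^#_{s,t}`
(`IsGermSolution.norm_remainder_le`).

Applied with `κ = α` this gives the regularity: `3α > 1 ≥ 2β`, so that `y^#` is as regular as the
areas, and `y` belongs to the space with exponent `β` (`IsGermSolution.of_exponent_le`). The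
constants here may be arbitrary, since only finiteness is used; in particular they may blow up as
`α → 1/3`.

Applied with `κ = β` it gives the bound. Let `T` bound all data. If `Q` is the `2β`-Hölder constant
of `y^#` on intervals of length at most `ℓ`, the defect is bounded by an expression *affine* in `Q`:
in the Taylor expansion of `σ` the quadratic bound is used only for the increments of `y' X` and of
the delayed path, and the Lipschitz bound for `y^#`
(`DataBound.norm_integrand_remainder_le`, `norm_germ_defect_le`). Hence
`Q ≤ Q / 2 + 5 T ^ 4` once `ℓ ^ β ≤ 1 / (4 T ^ 3)`, and since `Q` is finite, `Q ≤ 10 T ^ 4`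
(`IsGermSolution.norm_remainder_le_of_short`). This bound does not involve the position of the
interval because `y' = σ(y, z)`, with `z` the delayed path, is bounded. As `1 / β < 3`, polynomially
many such intervals cover `[0, r]`, and the increments of `y` add up to a polynomial bound
(`IsGermSolution.norm_remainder_le_global`). Finally `T` can be chosen as a constant multiple of
`((1 + ‖𝓧‖) (1 + ‖ξ‖)) ^ 2` (`IsControlled.dataBound`).
-/

/-! ### Sewing along dyadic partitions -/

/-- The constant `1 / (1 - 2^(1-θ))` of the sewing estimate with exponent `θ > 1`. -/
noncomputable def sewingConst (θ : ℝ) : ℝ := (1 - (2 : ℝ) ^ (1 - θ))⁻¹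

theorem two_rpow_one_sub_lt_one {θ : ℝ} (hθ : 1 < θ) : (2 : ℝ) ^ (1 - θ) < 1 :=
  Real.rpow_lt_one_of_one_lt_of_neg one_lt_two (by linarith)

theorem sewingConst_pos {θ : ℝ} (hθ : 1 < θ) : 0 < sewingConst θ :=
  inv_pos.2 (sub_pos.2 (two_rpow_one_sub_lt_one hθ))

theorem sum_range_two_mul {E : Type*} [AddCommMonoid E] (f : ℕ → E) (m : ℕ) :
    ∑ i ∈ Finset.range (2 * m), f i = ∑ j ∈ Finset.range m, (f (2 * j) + f (2 * j + 1)) := by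
  induction m with
  | zero => simp
  | succ m ih =>
    rw [show 2 * (m + 1) = 2 * m + 1 + 1 by ring, Finset.sum_range_succ, Finset.sum_range_succ, ih,
      Finset.sum_range_succ, add_assoc]

/-- The sum of `Ξ` over the partition of `[s, t]` into `n` intervals of equal length. -/
noncomputable def uniformSum {E : Type*} [AddCommMonoid E] (Ξ : ℝ → ℝ → E) (s t : ℝ) (n : ℕ) : E :=
  ∑ j ∈ Finset.range n, Ξ (s + (t - s) * (j / n)) (s + (t - s) * ((j + 1 : ℕ) / n))

section Sewing

variable {W : Type*} [NormedAddCommGroup W] {Ξ : ℝ → ℝ → W}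

/-- One dyadic refinement. -/
theorem norm_uniformSum_sub_le {s t M θ : ℝ} (hst : s < t)
    (hδ : ∀ a u b, s ≤ a → a < u → u < b → b ≤ t →
      ‖Ξ a b - Ξ a u - Ξ u b‖ ≤ M * (b - a) ^ θ) (k : ℕ) :
    ‖uniformSum Ξ s t (2 ^ k) - uniformSum Ξ s t (2 ^ (k + 1))‖
      ≤ M * (t - s) ^ θ * ((2 : ℝ) ^ (1 - θ)) ^ k := by
  have hd : 0 < t - s := sub_pos.2 hst
  have h2 : (0 : ℝ) < 2 ^ k := by positivity
  rw [uniformSum, uniformSum, pow_succ' 2 k, sum_range_two_mul, ← Finset.sum_sub_distrib]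
  have hterm : ∀ j ∈ Finset.range (2 ^ k),
      ‖Ξ (s + (t - s) * (j / (2 ^ k : ℕ))) (s + (t - s) * ((j + 1 : ℕ) / (2 ^ k : ℕ)))
        - (Ξ (s + (t - s) * ((2 * j : ℕ) / (2 * 2 ^ k : ℕ)))
            (s + (t - s) * ((2 * j + 1 : ℕ) / (2 * 2 ^ k : ℕ)))
          + Ξ (s + (t - s) * ((2 * j + 1 : ℕ) / (2 * 2 ^ k : ℕ)))
            (s + (t - s) * ((2 * j + 1 + 1 : ℕ) / (2 * 2 ^ k : ℕ))))‖
      ≤ M * ((t - s) / 2 ^ k) ^ θ := by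
    intro j hj
    have hj' : (j : ℝ) + 1 ≤ 2 ^ k := by exact_mod_cast Finset.mem_range.1 hj
    have e1 : (((2 * j : ℕ) : ℝ) / (2 * 2 ^ k : ℕ)) = j / (2 ^ k : ℕ) := by
      push_cast; field_simp
    have e2 : (((2 * j + 1 + 1 : ℕ) : ℝ) / (2 * 2 ^ k : ℕ)) = (j + 1 : ℕ) / (2 ^ k : ℕ) := by
      push_cast; field_simp; ring
    rw [e1, e2, ← sub_sub]
    refine (hδ _ _ _ ?_ ?_ ?_ ?_).trans_eq ?_
    · have : 0 ≤ (t - s) * ((j : ℝ) / (2 ^ k : ℕ)) := by positivity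
      linarith
    · rw [← e1]; push_cast; gcongr; linarith
    · rw [← e2]; push_cast; gcongr; linarith
    · have : (((j + 1 : ℕ) : ℝ) / (2 ^ k : ℕ)) ≤ 1 := by
        push_cast; rw [div_le_one h2]; exact hj'
      nlinarith
    · congr 2; push_cast; field_simp; ring
  refine (norm_sum_le_of_le _ hterm).trans_eq ?_
  rw [Finset.sum_const, Finset.card_range, nsmul_eq_mul, Real.div_rpow hd.le h2.le,
    ← Real.rpow_natCast, ← Real.rpow_natCast, ← Real.rpow_mul zero_le_two,
    ← Real.rpow_mul zero_le_two, sub_mul, one_mul, Real.rpow_sub zero_lt_two]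
  push_cast
  rw [Real.rpow_natCast, mul_comm θ]
  ring

theorem norm_uniformSum_two_pow_sub_le {s t M θ : ℝ} (hθ : 1 < θ) (hst : s < t) (hM : 0 ≤ M)
    (hδ : ∀ a u b, s ≤ a → a < u → u < b → b ≤ t →
      ‖Ξ a b - Ξ a u - Ξ u b‖ ≤ M * (b - a) ^ θ) (k : ℕ) :
    ‖uniformSum Ξ s t (2 ^ k) - Ξ s t‖ ≤ sewingConst θ * M * (t - s) ^ θ := by
  set ρ : ℝ := (2 : ℝ) ^ (1 - θ) with hρ
  have hρ0 : 0 ≤ ρ := by positivity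
  have hρ1 : ρ < 1 := two_rpow_one_sub_lt_one hθ
  have h0 : uniformSum Ξ s t (2 ^ 0) = Ξ s t := by simp [uniformSum]
  have hd : 0 ≤ (t - s) ^ θ := Real.rpow_nonneg (sub_pos.2 hst).le _
  have h1 : dist (uniformSum Ξ s t (2 ^ 0)) (uniformSum Ξ s t (2 ^ k))
      ≤ ∑ i ∈ Finset.range k, M * (t - s) ^ θ * ρ ^ i := by
    refine dist_le_range_sum_of_dist_le (f := fun k => uniformSum Ξ s t (2 ^ k)) k fun {i} _ => ?_
    rw [dist_eq_norm]
    exact norm_uniformSum_sub_le hst hδ i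
  rw [h0, dist_comm, dist_eq_norm, ← Finset.mul_sum] at h1
  refine h1.trans ?_
  have h2 : ∑ i ∈ Finset.range k, ρ ^ i ≤ sewingConst θ := by
    rw [sewingConst, ← tsum_geometric_of_lt_one hρ0 hρ1]
    exact (summable_geometric_of_lt_one hρ0 hρ1).sum_le_tsum _ fun i _ => pow_nonneg hρ0 i
  calc M * (t - s) ^ θ * ∑ i ∈ Finset.range k, ρ ^ i ≤ M * (t - s) ^ θ * sewingConst θ := by gcongr
    _ = _ := by ring

/-- If `Y t` is the limit of the Riemann sums of `Ξ` over `[0, t]` for every `t`, then the sums over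
uniform partitions of `[s, t]` approximate `Y t - Y s`: a partition of `[0, s]` is completed to one
of `[0, t]`. -/
theorem exists_norm_uniformSum_sub_lt {Y : ℝ → W} {s t : ℝ} (hs : 0 ≤ s) (hst : s ≤ t)
    (hI : ∀ x ∈ ({s, t} : Set ℝ), ∀ ε > 0, ∃ δ > 0, ∀ (n : ℕ) (τ : ℕ → ℝ), Monotone τ → τ 0 = 0 →
      τ n = x → (∀ i < n, τ (i + 1) - τ i < δ) →
      ‖∑ i ∈ Finset.range n, Ξ (τ i) (τ (i + 1)) - Y x‖ < ε)
    {ε : ℝ} (hε : 0 < ε) :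
    ∃ n₀ : ℕ, ∀ n ≥ n₀, ‖uniformSum Ξ s t n - (Y t - Y s)‖ < ε := by
  obtain ⟨δ₁, hδ₁, H₁⟩ := hI s (by simp) (ε / 2) (by positivity)
  obtain ⟨δ₂, hδ₂, H₂⟩ := hI t (by simp) (ε / 2) (by positivity)
  obtain ⟨n₀, hn₀⟩ := exists_nat_gt (t / min δ₁ δ₂)
  have hδ : 0 < min δ₁ δ₂ := lt_min hδ₁ hδ₂
  refine ⟨n₀ + 1, fun n hn => ?_⟩
  have hnpos : (0 : ℝ) < n := by
    have : 0 < n := by omega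
    exact_mod_cast this
  have hmesh : t / n < min δ₁ δ₂ := by
    rw [div_lt_iff₀ hδ] at hn₀
    rw [div_lt_iff₀ hnpos]
    have : (n₀ : ℝ) ≤ n := by exact_mod_cast (by omega : n₀ ≤ n)
    nlinarith
  have ht : 0 ≤ t := hs.trans hst
  -- `σ` runs through `[0, s]` in `n` equal steps, `τ` continues it through `[s, t]` in `n` steps.
  set σ : ℕ → ℝ := fun i => s * min ((i : ℝ) / n) 1 with hσ
  set τ : ℕ → ℝ := fun i => s * min ((i : ℝ) / n) 1 + (t - s) * max 0 (min ((i : ℝ) / n - 1) 1)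
    with hτ
  have hmono : ∀ {i j : ℕ}, i ≤ j → (i : ℝ) / n ≤ (j : ℝ) / n := fun hij => by
    gcongr
  have hσm : Monotone σ := fun i j hij => by
    have := hmono hij
    simp only [hσ]; gcongr
  have hτm : Monotone τ := fun i j hij => by
    have h1 := hmono hij
    have h2 : 0 ≤ t - s := by linarith
    simp only [hτ]; gcongr
  have hσ1 : ∀ i ≤ n, σ i = s * (i / n) := fun i hi => by
    simp only [hσ]; rw [min_eq_left]
    rw [div_le_one hnpos]; exact_mod_cast hi
  have hτ1 : ∀ i ≤ n, τ i = s * (i / n) := fun i hi => by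
    have hi' : (i : ℝ) / n ≤ 1 := by rw [div_le_one hnpos]; exact_mod_cast hi
    simp only [hτ]
    rw [min_eq_left hi', max_eq_left ((min_le_left _ _).trans (by linarith))]
    ring
  have hτ2 : ∀ j ≤ n, τ (n + j) = s + (t - s) * (j / n) := fun j hj => by
    have hj' : (j : ℝ) / n ≤ 1 := by rw [div_le_one hnpos]; exact_mod_cast hj
    have hj0 : 0 ≤ (j : ℝ) / n := by positivity
    have e : ((n + j : ℕ) : ℝ) / n = 1 + j / n := by push_cast; field_simp
    simp only [hτ]
    rw [e, add_sub_cancel_left, min_eq_left hj', max_eq_right hj0, min_eq_right (by linarith),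
      mul_one]
  have step1 : s * (1 / n) ≤ t / n := by
    rw [mul_one_div]; gcongr
  have step2 : (t - s) * (1 / n) ≤ t / n := by
    rw [mul_one_div]; gcongr; linarith
  have A₁ := H₁ n σ hσm (by simp [hσ]) (by rw [hσ1 n le_rfl, div_self hnpos.ne', mul_one])
    (fun i hi => by
      rw [hσ1 _ hi, hσ1 _ hi.le]; push_cast
      have : s * (((i : ℝ) + 1) / n) - s * (i / n) = s * (1 / n) := by ring
      rw [this]; exact (step1.trans_lt hmesh).trans_le (min_le_left _ _))
  have A₂ := H₂ (n + n) τ hτm (by simp [hτ])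
    (by rw [hτ2 n le_rfl, div_self hnpos.ne']; ring)
    (fun i hi => by
      rcases lt_or_ge i n with h | h
      · rw [hτ1 _ h, hτ1 _ h.le]; push_cast
        have : s * (((i : ℝ) + 1) / n) - s * (i / n) = s * (1 / n) := by ring
        rw [this]; exact (step1.trans_lt hmesh).trans_le (min_le_right _ _)
      · obtain ⟨j, rfl⟩ := Nat.exists_eq_add_of_le h
        have hj : j < n := by omega
        rw [add_assoc, hτ2 _ hj, hτ2 _ hj.le]; push_cast
        have : s + (t - s) * (((j : ℝ) + 1) / n) - (s + (t - s) * (j / n)) = (t - s) * (1 / n) := by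
          ring
        rw [this]; exact (step2.trans_lt hmesh).trans_le (min_le_right _ _))
  have e : ∑ i ∈ Finset.range (n + n), Ξ (τ i) (τ (i + 1))
      = ∑ i ∈ Finset.range n, Ξ (σ i) (σ (i + 1)) + uniformSum Ξ s t n := by
    rw [Finset.sum_range_add, uniformSum]
    congr 1
    · refine Finset.sum_congr rfl fun i hi => ?_
      have hi := Finset.mem_range.1 hi
      rw [hτ1 _ hi, hτ1 _ hi.le, hσ1 _ hi, hσ1 _ hi.le]
    · refine Finset.sum_congr rfl fun i hi => ?_
      have hi := Finset.mem_range.1 hi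
      rw [add_assoc, hτ2 _ hi, hτ2 _ hi.le]
  rw [e] at A₂
  have e2 : uniformSum Ξ s t n - (Y t - Y s)
      = (∑ i ∈ Finset.range n, Ξ (σ i) (σ (i + 1)) + uniformSum Ξ s t n - Y t)
        - (∑ i ∈ Finset.range n, Ξ (σ i) (σ (i + 1)) - Y s) := by abel
  rw [e2]
  refine (norm_sub_le _ _).trans_lt ?_
  linarith

/-- The sewing estimate, for a germ whose integral is known to exist. -/
theorem norm_integral_sub_germ_le {Y : ℝ → W} {s t M θ : ℝ} (hθ : 1 < θ) (hs : 0 ≤ s) (hst : s < t)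
    (hM : 0 ≤ M)
    (hI : ∀ x ∈ ({s, t} : Set ℝ), ∀ ε > 0, ∃ δ > 0, ∀ (n : ℕ) (τ : ℕ → ℝ), Monotone τ → τ 0 = 0 →
      τ n = x → (∀ i < n, τ (i + 1) - τ i < δ) →
      ‖∑ i ∈ Finset.range n, Ξ (τ i) (τ (i + 1)) - Y x‖ < ε)
    (hδ : ∀ a u b, s ≤ a → a < u → u < b → b ≤ t →
      ‖Ξ a b - Ξ a u - Ξ u b‖ ≤ M * (b - a) ^ θ) :
    ‖Y t - Y s - Ξ s t‖ ≤ sewingConst θ * M * (t - s) ^ θ := by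
  refine le_of_forall_pos_lt_add fun ε hε => ?_
  obtain ⟨n₀, hn₀⟩ := exists_norm_uniformSum_sub_lt hs hst.le hI hε
  have h1 := hn₀ (2 ^ n₀) Nat.lt_two_pow_self.le
  have h2 := norm_uniformSum_two_pow_sub_le hθ hst hM hδ n₀
  have e : Y t - Y s - Ξ s t = (uniformSum Ξ s t (2 ^ n₀) - Ξ s t)
      - (uniformSum Ξ s t (2 ^ n₀) - (Y t - Y s)) := by abel
  rw [e]
  exact (norm_sub_le _ _).trans_lt (by linarith)

end Sewing

/-! ### Tensors and the coefficient `σ` -/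

section Coefficient

variable {U W : Type*} [NormedAddCommGroup U] [NormedSpace ℝ U]
  [NormedAddCommGroup W] [NormedSpace ℝ W]

theorem applyTensor_tmul (A : U →L[ℝ] U →L[ℝ] W) (u v : U) :
    applyTensor A (u ⊗ₜ[ℝ] v) = A u v := rfl

theorem applyTensor_sub (A B : U →L[ℝ] U →L[ℝ] W) (z : U ⊗[ℝ] U) :
    applyTensor (A - B) z = applyTensor A z - applyTensor B z := by
  induction z using TensorProduct.induction_on with
  | zero => simp
  | tmul u v => simp [applyTensor_tmul]
  | add x y hx hy => rw [map_add, map_add, map_add, hx, hy]; abel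

/-- On a finite-dimensional space every linear functional is bounded by any given norm. -/
theorem exists_abs_le_seminorm {V : Type*} [AddCommGroup V] [Module ℝ V] [FiniteDimensional ℝ V]
    (N : Seminorm ℝ V) (hN : ∀ z, N z = 0 → z = 0) (f : V →ₗ[ℝ] ℝ) :
    ∃ C, 0 ≤ C ∧ ∀ z, |f z| ≤ C * N z := by
  let _ : NormedAddCommGroup V := AddGroupNorm.toNormedAddCommGroup
    { toFun := N, map_zero' := map_zero N, add_le' := map_add_le_add N, neg' := map_neg_eq_map N,
      eq_zero_of_map_eq_zero' := hN }
  let _ : NormedSpace ℝ V := { norm_smul_le := fun a b => (map_smul_eq_mul N a b).le }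
  exact ⟨‖LinearMap.toContinuousLinearMap f‖, norm_nonneg _,
    fun z => (LinearMap.toContinuousLinearMap f).le_opNorm z⟩

theorem exists_norm_applyTensor_le [FiniteDimensional ℝ U]
    (N : Seminorm ℝ (U ⊗[ℝ] U)) (hN : ∀ z, N z = 0 → z = 0) :
    ∃ C, 0 ≤ C ∧ ∀ (A : U →L[ℝ] U →L[ℝ] W) (z : U ⊗[ℝ] U),
      ‖applyTensor A z‖ ≤ C * ‖A‖ * N z := by
  let b := Module.finBasis ℝ U
  let c := b.tensorProduct b
  choose K hK0 hK using fun p => exists_abs_le_seminorm N hN (c.coord p)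
  refine ⟨∑ p, K p * (‖b p.1‖ * ‖b p.2‖), Finset.sum_nonneg fun p _ =>
    mul_nonneg (hK0 p) (by positivity), fun A z => ?_⟩
  conv_lhs => rw [← c.sum_repr z, map_sum]
  rw [Finset.sum_mul, Finset.sum_mul]
  refine norm_sum_le_of_le _ fun p _ => ?_
  rw [map_smul, norm_smul, Module.Basis.tensorProduct_apply, applyTensor_tmul]
  have h1 : ‖c.repr z p‖ ≤ K p * N z := hK p z
  have h2 : ‖A (b p.1) (b p.2)‖ ≤ ‖A‖ * ‖b p.1‖ * ‖b p.2‖ := A.le_opNorm₂ _ _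
  calc ‖c.repr z p‖ * ‖A (b p.1) (b p.2)‖
      ≤ (K p * N z) * (‖A‖ * ‖b p.1‖ * ‖b p.2‖) :=
        mul_le_mul h1 h2 (norm_nonneg _) (mul_nonneg (hK0 p) (apply_nonneg N z))
    _ = _ := by ring

theorem IsCb.exists_bound {E F : Type*} [NormedAddCommGroup E] [NormedSpace ℝ E]
    [NormedAddCommGroup F] [NormedSpace ℝ F] {σ : E → F} (hσ : IsCb 3 σ) :
    ∃ C, 0 ≤ C ∧ (∀ p, ‖σ p‖ ≤ C) ∧ (∀ p, ‖fderiv ℝ σ p‖ ≤ C) ∧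
      (∀ p q, ‖σ p - σ q‖ ≤ C * ‖p - q‖) ∧
      (∀ p q, ‖fderiv ℝ σ p - fderiv ℝ σ q‖ ≤ C * ‖p - q‖) ∧
      ∀ p v, ‖σ (p + v) - σ p - fderiv ℝ σ p v‖ ≤ C * ‖v‖ ^ 2 := by
  obtain ⟨hd, hb⟩ := hσ
  obtain ⟨C₀, h₀⟩ := hb 0 (by norm_num)
  obtain ⟨C₁, h₁⟩ := hb 1 (by norm_num)
  obtain ⟨C₂, h₂⟩ := hb 2 (by norm_num)
  simp only [norm_iteratedFDeriv_zero] at h₀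
  simp only [norm_iteratedFDeriv_one] at h₁
  have h₂' : ∀ p, ‖fderiv ℝ (fderiv ℝ σ) p‖ ≤ C₂ := fun p => by
    rw [← norm_iteratedFDeriv_one, norm_iteratedFDeriv_fderiv]; exact h₂ p
  have d1 : Differentiable ℝ σ := hd.differentiable (by norm_num)
  have d2 : Differentiable ℝ (fderiv ℝ σ) :=
    (hd.fderiv_right (m := 1) (by norm_num)).differentiable (by norm_num)
  have l1 : ∀ p q, ‖σ p - σ q‖ ≤ C₁ * ‖p - q‖ := fun p q =>
    convex_univ.norm_image_sub_le_of_norm_fderiv_le (fun x _ => d1 x) (fun x _ => h₁ x)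
      (mem_univ q) (mem_univ p)
  have l2 : ∀ p q, ‖fderiv ℝ σ p - fderiv ℝ σ q‖ ≤ C₂ * ‖p - q‖ := fun p q =>
    convex_univ.norm_image_sub_le_of_norm_fderiv_le (fun x _ => d2 x) (fun x _ => h₂' x)
      (mem_univ q) (mem_univ p)
  have c₀ : 0 ≤ C₀ := (norm_nonneg _).trans (h₀ 0)
  have c₁ : 0 ≤ C₁ := (norm_nonneg _).trans (h₁ 0)
  have c₂ : 0 ≤ C₂ := (norm_nonneg (fderiv ℝ (fderiv ℝ σ) 0)).trans (h₂' 0)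
  have l3 : ∀ p v, ‖σ (p + v) - σ p - fderiv ℝ σ p v‖ ≤ C₂ * ‖v‖ ^ 2 := fun p v => by
    have := (convex_closedBall p ‖v‖).norm_image_sub_le_of_norm_fderiv_le' (f := σ)
      (φ := fderiv ℝ σ p) (C := C₂ * ‖v‖) (x := p) (y := p + v) (fun x _ => d1 x)
      (fun x hx => (l2 x p).trans (by
        have : ‖x - p‖ ≤ ‖v‖ := by simpa [dist_eq_norm] using hx
        gcongr))
      (by simp) (by simp [dist_eq_norm])
    rw [add_sub_cancel_left] at this
    exact this.trans_eq (by ring)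
  refine ⟨C₀ + C₁ + C₂, by positivity, ?_, ?_, ?_, ?_, ?_⟩
  · exact fun p => (h₀ p).trans (by linarith)
  · exact fun p => (h₁ p).trans (by linarith)
  · exact fun p q => (l1 p q).trans (by gcongr; linarith)
  · exact fun p q => (l2 p q).trans (by gcongr; linarith)
  · exact fun p v => (l3 p v).trans (by gcongr; linarith)

/-- The bounds on `σ` and `U ⊗ U` which the estimates use. -/
structure CoefficientBound (N : Seminorm ℝ (U ⊗[ℝ] U)) (σ : W × W → U →L[ℝ] W) (T : ℝ) :
    Prop where
  norm_le : ∀ p, ‖σ p‖ ≤ T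
  lipschitz : ∀ p q, ‖σ p - σ q‖ ≤ T * ‖p - q‖
  fderiv_le : ∀ p, ‖fderiv ℝ σ p‖ ≤ T
  fderiv_lipschitz : ∀ p q, ‖fderiv ℝ σ p - fderiv ℝ σ q‖ ≤ T * ‖p - q‖
  taylor : ∀ p v, ‖σ (p + v) - σ p - fderiv ℝ σ p v‖ ≤ T * ‖v‖ ^ 2
  tensor : ∀ (A : U →L[ℝ] U →L[ℝ] W) z, ‖applyTensor A z‖ ≤ T * ‖A‖ * N z

theorem CoefficientBound.mono {N : Seminorm ℝ (U ⊗[ℝ] U)} {σ : W × W → U →L[ℝ] W} {T T' : ℝ}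
    (h : CoefficientBound N σ T) (hT : T ≤ T') : CoefficientBound N σ T' where
  norm_le p := (h.norm_le p).trans hT
  lipschitz p q := (h.lipschitz p q).trans (by gcongr)
  fderiv_le p := (h.fderiv_le p).trans hT
  fderiv_lipschitz p q := (h.fderiv_lipschitz p q).trans (by gcongr)
  taylor p v := (h.taylor p v).trans (by gcongr)
  tensor A z := (h.tensor A z).trans (by have := apply_nonneg N z; gcongr)

theorem exists_coefficientBound [FiniteDimensional ℝ U]
    (N : Seminorm ℝ (U ⊗[ℝ] U)) (hN : ∀ z, N z = 0 → z = 0)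
    {σ : W × W → U →L[ℝ] W} (hσ : IsCb 3 σ) : ∃ T, CoefficientBound N σ T := by
  obtain ⟨C, hC0, h₀, h₁, h₂, h₄, h₅⟩ := hσ.exists_bound
  obtain ⟨C₃, h₃, h₃'⟩ := exists_norm_applyTensor_le (W := W) N hN
  have hC : C ≤ C + C₃ := by linarith
  refine ⟨C + C₃, fun p => (h₀ p).trans hC, fun p q => (h₂ p q).trans (by gcongr),
    fun p => (h₁ p).trans hC, fun p q => (h₄ p q).trans (by gcongr),
    fun p v => (h₅ p v).trans (by gcongr),
    fun A z => (h₃' A z).trans (by have := apply_nonneg N z; gcongr; linarith)⟩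

theorem norm_partialX_sub_le (σ : W × W → U →L[ℝ] W) (p q : W × W) :
    ‖partialX σ p - partialX σ q‖ ≤ ‖fderiv ℝ σ p - fderiv ℝ σ q‖ := by
  rw [partialX, partialX, ← ContinuousLinearMap.sub_comp]
  refine (ContinuousLinearMap.opNorm_comp_le _ _).trans
    (mul_le_of_le_one_right (norm_nonneg _) (ContinuousLinearMap.norm_inl_le_one ℝ W W))

theorem norm_partialY_sub_le (σ : W × W → U →L[ℝ] W) (p q : W × W) :
    ‖partialY σ p - partialY σ q‖ ≤ ‖fderiv ℝ σ p - fderiv ℝ σ q‖ := by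
  rw [partialY, partialY, ← ContinuousLinearMap.sub_comp]
  refine (ContinuousLinearMap.opNorm_comp_le _ _).trans
    (mul_le_of_le_one_right (norm_nonneg _) (ContinuousLinearMap.norm_inr_le_one ℝ W W))

theorem norm_partialX_le (σ : W × W → U →L[ℝ] W) (p : W × W) :
    ‖partialX σ p‖ ≤ ‖fderiv ℝ σ p‖ :=
  (ContinuousLinearMap.opNorm_comp_le _ _).trans
    (mul_le_of_le_one_right (norm_nonneg _) (ContinuousLinearMap.norm_inl_le_one ℝ W W))

theorem norm_partialY_le (σ : W × W → U →L[ℝ] W) (p : W × W) :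
    ‖partialY σ p‖ ≤ ‖fderiv ℝ σ p‖ :=
  (ContinuousLinearMap.opNorm_comp_le _ _).trans
    (mul_le_of_le_one_right (norm_nonneg _) (ContinuousLinearMap.norm_inr_le_one ℝ W W))

end Coefficient

/-! ### The defect of the germ -/

section Germ

variable {U W : Type*} [NormedAddCommGroup U] [NormedSpace ℝ U]
  [NormedAddCommGroup W] [NormedSpace ℝ W]

/-- The compensated summand `σ(y,z)_s X_{s,t} + σ_x(y,z)_s y'_s 𝔸_{s,t} + σ_y(y,z)_s z'_s 𝔹_{s,t}`,
where `z` stands for the delayed path and `z'` for its derivative with respect to the delayed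
signal. -/
noncomputable def germ (σ : W × W → U →L[ℝ] W) (X : ℝ → U) (𝔸 𝔹 : ℝ → ℝ → U ⊗[ℝ] U) (z : ℝ → W)
    (z' : ℝ → U →L[ℝ] W) (y : ℝ → W) (y' : ℝ → U →L[ℝ] W) (s t : ℝ) : W :=
  σ (y s, z s) (X t - X s) + applyTensor ((partialX σ (y s, z s)).comp (y' s)) (𝔸 s t)
    + applyTensor ((partialY σ (y s, z s)).comp (z' s)) (𝔹 s t)

/-- The constant `T ≥ 1` bounds, with Hölder exponent `κ` on `[0, r]`, the signal `X`, the delayed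
signal `V`, their areas `𝔸`, `𝔹`, and the delayed path `z`, which is controlled by `V` with derivative
`z'`. -/
structure DataBound (N : Seminorm ℝ (U ⊗[ℝ] U)) (X V : ℝ → U) (𝔸 𝔹 : ℝ → ℝ → U ⊗[ℝ] U)
    (z : ℝ → W) (z' : ℝ → U →L[ℝ] W) (r κ T : ℝ) : Prop where
  exponent_pos : 0 < κ
  one_le : 1 ≤ T
  rpow_le : r ^ κ ≤ T
  signal : ∀ s t, 0 ≤ s → s < t → t ≤ r → ‖X t - X s‖ ≤ T * (t - s) ^ κ
  delayedSignal : ∀ s t, 0 ≤ s → s < t → t ≤ r → ‖V t - V s‖ ≤ T * (t - s) ^ κ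
  area : ∀ s t, 0 ≤ s → s < t → t ≤ r → N (𝔸 s t) ≤ T * (t - s) ^ (2 * κ)
  delayedArea : ∀ s t, 0 ≤ s → s < t → t ≤ r → N (𝔹 s t) ≤ T * (t - s) ^ (2 * κ)
  area_chen : ∀ s u t, 𝔸 s t = 𝔸 s u + 𝔸 u t + (X u - X s) ⊗ₜ[ℝ] (X t - X u)
  delayedArea_chen : ∀ s u t, 𝔹 s t = 𝔹 s u + 𝔹 u t + (V u - V s) ⊗ₜ[ℝ] (X t - X u)
  deriv : ∀ s, 0 ≤ s → s ≤ r → ‖z' s‖ ≤ T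
  deriv_holder : ∀ s t, 0 ≤ s → s < t → t ≤ r → ‖z' t - z' s‖ ≤ T * (t - s) ^ κ
  remainder_le : ∀ s t, 0 ≤ s → s < t → t ≤ r →
    ‖z t - z s - z' s (V t - V s)‖ ≤ T * (t - s) ^ (2 * κ)

variable {N : Seminorm ℝ (U ⊗[ℝ] U)} {σ : W × W → U →L[ℝ] W} {X V : ℝ → U}
  {𝔸 𝔹 : ℝ → ℝ → U ⊗[ℝ] U} {z : ℝ → W} {z' : ℝ → U →L[ℝ] W} {y : ℝ → W} {y' : ℝ → U →L[ℝ] W}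
  {r κ T : ℝ}

theorem rpow_two_mul {d : ℝ} (hd : 0 ≤ d) (κ : ℝ) : d ^ (2 * κ) = (d ^ κ) ^ 2 := by
  rw [mul_comm, Real.rpow_mul hd, Real.rpow_two]

theorem rpow_three_mul {d : ℝ} (hd : 0 ≤ d) (κ : ℝ) : d ^ (3 * κ) = (d ^ κ) ^ 3 := by
  rw [mul_comm, Real.rpow_mul hd]; norm_cast

theorem DataBound.rpow_sub_le (h : DataBound N X V 𝔸 𝔹 z z' r κ T) {s t : ℝ} (hs : 0 ≤ s)
    (hst : s < t) (ht : t ≤ r) : (t - s) ^ κ ≤ T :=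
  (Real.rpow_le_rpow (sub_pos.2 hst).le (by linarith) h.exponent_pos.le).trans h.rpow_le

/-- The increments of the delayed path. -/
theorem DataBound.norm_sub_le (h : DataBound N X V 𝔸 𝔹 z z' r κ T) {s t : ℝ} (hs : 0 ≤ s)
    (hst : s < t) (ht : t ≤ r) : ‖z t - z s‖ ≤ 2 * T ^ 2 * (t - s) ^ κ := by
  have hT := h.one_le
  have h1 := h.remainder_le s t hs hst ht
  rw [rpow_two_mul (sub_pos.2 hst).le] at h1
  have h2 := h.delayedSignal s t hs hst ht
  have h3 := h.deriv s hs (by linarith)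
  have h4 := h.rpow_sub_le hs hst ht
  have h5 : ‖z' s (V t - V s)‖ ≤ T * (T * (t - s) ^ κ) :=
    ((z' s).le_opNorm _).trans (by gcongr)
  have h0 : 0 ≤ (t - s) ^ κ := Real.rpow_nonneg (sub_pos.2 hst).le _
  calc ‖z t - z s‖ = ‖(z t - z s - z' s (V t - V s)) + z' s (V t - V s)‖ := by
        rw [sub_add_cancel]
    _ ≤ T * ((t - s) ^ κ) ^ 2 + T * (T * (t - s) ^ κ) := (norm_add_le _ _).trans (add_le_add h1 h5)
    _ ≤ T * ((t - s) ^ κ * T) + T * (T * (t - s) ^ κ) := by rw [sq]; gcongr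
    _ = _ := by ring

/-- The increments of `y`, from a bound on its remainder. -/
theorem DataBound.norm_solution_sub_le (h : DataBound N X V 𝔸 𝔹 z z' r κ T)
    {s t Q : ℝ} (hs : 0 ≤ s) (hst : s < t) (ht : t ≤ r) (hy' : ‖y' s‖ ≤ T)
    (hQ : ‖remainder X y y' s t‖ ≤ Q * (t - s) ^ (2 * κ)) :
    ‖y t - y s‖ ≤ T ^ 2 * (t - s) ^ κ + Q * ((t - s) ^ κ) ^ 2 := by
  have hT := h.one_le
  rw [rpow_two_mul (sub_pos.2 hst).le] at hQ
  have h2 := h.signal s t hs hst ht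
  have h5 : ‖y' s (X t - X s)‖ ≤ T * (T * (t - s) ^ κ) :=
    ((y' s).le_opNorm _).trans (by gcongr)
  calc ‖y t - y s‖ = ‖remainder X y y' s t + y' s (X t - X s)‖ := by
        rw [remainder, sub_add_cancel]
    _ ≤ _ := (norm_add_le _ _).trans (by linarith)

/-- The integrand is controlled by the signal and the delayed signal. The quadratic Taylor bound is
applied only to the part of the increment of `(y, z)` which does not contain the remainder of `y`;
for the remainder the Lipschitz bound is used, so that the result is affine in `Q`. -/
theorem DataBound.norm_integrand_remainder_le (hσ : CoefficientBound N σ T)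
    (h : DataBound N X V 𝔸 𝔹 z z' r κ T)
    {s t Q : ℝ} (hs : 0 ≤ s) (hst : s < t) (ht : t ≤ r) (hy' : ‖y' s‖ ≤ T)
    (hQ : ‖remainder X y y' s t‖ ≤ Q * (t - s) ^ (2 * κ)) :
    ‖σ (y t, z t) - σ (y s, z s) - partialX σ (y s, z s) (y' s (X t - X s))
        - partialY σ (y s, z s) (z' s (V t - V s))‖
      ≤ (T * Q + 4 * T ^ 5 + T ^ 2) * ((t - s) ^ κ) ^ 2 := by
  have hT := h.one_le
  set d := (t - s) ^ κ with hd
  have hd0 : 0 ≤ d := Real.rpow_nonneg (sub_pos.2 hst).le _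
  set p := (y s, z s) with hp
  set v : W × W := (y' s (X t - X s), z t - z s) with hv
  have hsplit : fderiv ℝ σ p v
      = partialX σ p (y' s (X t - X s)) + partialY σ p (z t - z s) := by
    rw [partialX, partialY, ContinuousLinearMap.comp_apply, ContinuousLinearMap.comp_apply,
      ← map_add]
    simp [hv]
  have e : σ (y t, z t) - σ p - partialX σ p (y' s (X t - X s))
        - partialY σ p (z' s (V t - V s))
      = (σ (y t, z t) - σ (p + v)) + (σ (p + v) - σ p - fderiv ℝ σ p v)
        + partialY σ p (z t - z s - z' s (V t - V s)) := by
    rw [hsplit, map_sub (partialY σ p) (z t - z s)]; abel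
  have h1 : ‖σ (y t, z t) - σ (p + v)‖ ≤ T * (Q * d ^ 2) := by
    refine (hσ.lipschitz _ _).trans ?_
    have : (y t, z t) - (p + v) = (remainder X y y' s t, 0) := by
      simp only [hp, hv, remainder, Prod.mk_add_mk, Prod.mk_sub_mk, Prod.mk.injEq]
      constructor <;> abel
    rw [this, Prod.norm_mk, norm_zero, max_eq_left (norm_nonneg _)]
    rw [rpow_two_mul (sub_pos.2 hst).le] at hQ
    gcongr
  have h2 : ‖v‖ ≤ 2 * T ^ 2 * d := by
    have h5 : ‖y' s (X t - X s)‖ ≤ T * (T * d) :=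
      ((y' s).le_opNorm _).trans (by have := h.signal s t hs hst ht; gcongr)
    rw [hv, Prod.norm_mk]
    refine max_le (h5.trans ?_) (h.norm_sub_le hs hst ht)
    have : 0 ≤ T ^ 2 * d := by positivity
    linarith
  have h3 : ‖σ (p + v) - σ p - fderiv ℝ σ p v‖ ≤ T * (2 * T ^ 2 * d) ^ 2 :=
    (hσ.taylor p v).trans (by gcongr)
  have h4 : ‖partialY σ p (z t - z s - z' s (V t - V s))‖ ≤ T * (T * d ^ 2) := by
    refine ((partialY σ p).le_opNorm _).trans ?_
    have a := (norm_partialY_le σ p).trans (hσ.fderiv_le p)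
    have b := h.remainder_le s t hs hst ht
    rw [rpow_two_mul (sub_pos.2 hst).le] at b
    gcongr
  rw [e]
  calc _ ≤ T * (Q * d ^ 2) + T * (2 * T ^ 2 * d) ^ 2 + T * (T * d ^ 2) :=
        norm_add₃_le.trans (by linarith)
    _ = _ := by ring

/-- Chen's relation turns the defect of the germ into products of small increments. -/
theorem germ_defect_eq (h : DataBound N X V 𝔸 𝔹 z z' r κ T) (s u t : ℝ) :
    germ σ X 𝔸 𝔹 z z' y y' s t - germ σ X 𝔸 𝔹 z z' y y' s u - germ σ X 𝔸 𝔹 z z' y y' u t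
      = -((σ (y u, z u) - σ (y s, z s)
            - (partialX σ (y s, z s)) (y' s (X u - X s))
            - (partialY σ (y s, z s)) (z' s (V u - V s))) (X t - X u)
          + applyTensor ((partialX σ (y u, z u)).comp (y' u)
              - (partialX σ (y s, z s)).comp (y' s)) (𝔸 u t)
          + applyTensor ((partialY σ (y u, z u)).comp (z' u)
              - (partialY σ (y s, z s)).comp (z' s)) (𝔹 u t)) := by
  simp only [germ, h.area_chen s u t, h.delayedArea_chen s u t, applyTensor_sub, map_add, map_sub,
    applyTensor_tmul, ContinuousLinearMap.comp_apply, sub_apply]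
  abel

theorem norm_germ_defect_le (hσ : CoefficientBound N σ T) (h : DataBound N X V 𝔸 𝔹 z z' r κ T)
    (hy' : ∀ s, 0 ≤ s → s ≤ r → y' s = σ (y s, z s))
    {s u t Q ε : ℝ} (hs : 0 ≤ s) (hsu : s < u) (hut : u < t) (ht : t ≤ r)
    (hε : (t - s) ^ κ ≤ ε) (hQ0 : 0 ≤ Q)
    (hQ : ‖remainder X y y' s u‖ ≤ Q * (u - s) ^ (2 * κ)) :
    ‖germ σ X 𝔸 𝔹 z z' y y' s t - germ σ X 𝔸 𝔹 z z' y y' s u - germ σ X 𝔸 𝔹 z z' y y' u t‖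
      ≤ ((T ^ 2 + 3 * T ^ 4 * ε) * Q + 12 * T ^ 6) * (t - s) ^ (3 * κ) := by
  have hT := h.one_le
  have hκ := h.exponent_pos.le
  set d := (t - s) ^ κ with hd
  have hd0 : 0 ≤ d := Real.rpow_nonneg (by linarith) _
  have hε0 : 0 ≤ ε := hd0.trans hε
  have hdT : d ≤ T := h.rpow_sub_le hs (by linarith) ht
  have hsud : (u - s) ^ κ ≤ d := Real.rpow_le_rpow (by linarith) (by linarith) hκ
  have hutd : (t - u) ^ κ ≤ d := Real.rpow_le_rpow (by linarith) (by linarith) hκ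
  have hsu0 : 0 ≤ (u - s) ^ κ := Real.rpow_nonneg (by linarith) _
  have hut0 : 0 ≤ (t - u) ^ κ := Real.rpow_nonneg (by linarith) _
  have hur : u ≤ r := by linarith
  have hu : 0 ≤ u := by linarith
  have hy's : ‖y' s‖ ≤ T := by rw [hy' s hs (by linarith)]; exact hσ.norm_le _
  have hy'u : ‖y' u‖ ≤ T := by rw [hy' u hu hur]; exact hσ.norm_le _
  have hX : ‖X t - X u‖ ≤ T * d := (h.signal u t hu hut ht).trans (by gcongr)
  have hA : N (𝔸 u t) ≤ T * d ^ 2 := (h.area u t hu hut ht).trans (by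
    rw [rpow_two_mul (sub_pos.2 hut).le]; gcongr)
  have hB : N (𝔹 u t) ≤ T * d ^ 2 := (h.delayedArea u t hu hut ht).trans (by
    rw [rpow_two_mul (sub_pos.2 hut).le]; gcongr)
  have hE := (h.norm_integrand_remainder_le hσ hs hsu hur hy's hQ).trans
    (mul_le_mul_of_nonneg_left (pow_le_pow_left₀ hsu0 hsud 2) (by positivity))
  have hp : ‖(y u, z u) - (y s, z s)‖ ≤ (2 * T ^ 2 + Q * ε) * d := by
    rw [Prod.mk_sub_mk, Prod.norm_mk]
    refine max_le ((h.norm_solution_sub_le hs hsu hur hy's hQ).trans ?_)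
      ((h.norm_sub_le hs hsu hur).trans ?_)
    · calc T ^ 2 * (u - s) ^ κ + Q * ((u - s) ^ κ) ^ 2 ≤ T ^ 2 * d + Q * d ^ 2 := by gcongr
        _ ≤ T ^ 2 * d + Q * (ε * d) + T ^ 2 * d := by
          rw [sq d]
          have : 0 ≤ T ^ 2 * d := by positivity
          have : Q * (d * d) ≤ Q * (ε * d) := by gcongr
          linarith
        _ = _ := by ring
    · calc 2 * T ^ 2 * (u - s) ^ κ ≤ 2 * T ^ 2 * d := by gcongr
        _ ≤ _ := by gcongr; linarith [mul_nonneg hQ0 hε0]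
  set Y := (2 * T ^ 2 + Q * ε) * d with hY
  have hY0 : 0 ≤ Y := by positivity
  have hfd := (hσ.fderiv_lipschitz (y u, z u) (y s, z s)).trans
    (mul_le_mul_of_nonneg_left hp (by linarith))
  have hζ₀ : ‖(partialX σ (y u, z u)).comp (y' u) - (partialX σ (y s, z s)).comp (y' s)‖
      ≤ 2 * T ^ 2 * Y := by
    have e : (partialX σ (y u, z u)).comp (y' u) - (partialX σ (y s, z s)).comp (y' s)
        = (partialX σ (y u, z u) - partialX σ (y s, z s)).comp (y' u)
          + (partialX σ (y s, z s)).comp (y' u - y' s) := by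
      rw [ContinuousLinearMap.sub_comp, ContinuousLinearMap.comp_sub]; abel
    have a : ‖y' u - y' s‖ ≤ T * Y := by
      rw [hy' s hs (by linarith), hy' u hu hur]
      exact (hσ.lipschitz _ _).trans (by gcongr)
    have b := (norm_partialX_sub_le σ (y u, z u) (y s, z s)).trans hfd
    have c := (norm_partialX_le σ (y s, z s)).trans (hσ.fderiv_le _)
    rw [e]
    calc _ ≤ T * Y * T + T * (T * Y) :=
          (norm_add_le _ _).trans (add_le_add
            ((ContinuousLinearMap.opNorm_comp_le _ _).trans (by gcongr))
            ((ContinuousLinearMap.opNorm_comp_le _ _).trans (by gcongr)))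
      _ = _ := by ring
  have hζ₁ : ‖(partialY σ (y u, z u)).comp (z' u) - (partialY σ (y s, z s)).comp (z' s)‖
      ≤ T ^ 2 * Y + T ^ 2 * d := by
    have e : (partialY σ (y u, z u)).comp (z' u) - (partialY σ (y s, z s)).comp (z' s)
        = (partialY σ (y u, z u) - partialY σ (y s, z s)).comp (z' u)
          + (partialY σ (y s, z s)).comp (z' u - z' s) := by
      rw [ContinuousLinearMap.sub_comp, ContinuousLinearMap.comp_sub]; abel
    have a : ‖z' u - z' s‖ ≤ T * d := (h.deriv_holder s u hs hsu hur).trans (by gcongr)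
    have b := (norm_partialY_sub_le σ (y u, z u) (y s, z s)).trans hfd
    have c := (norm_partialY_le σ (y s, z s)).trans (hσ.fderiv_le _)
    have f := h.deriv u hu hur
    rw [e]
    calc _ ≤ T * Y * T + T * (T * d) :=
          (norm_add_le _ _).trans (add_le_add
            ((ContinuousLinearMap.opNorm_comp_le _ _).trans (by gcongr))
            ((ContinuousLinearMap.opNorm_comp_le _ _).trans (by gcongr)))
      _ = _ := by ring
  rw [germ_defect_eq h, norm_neg, rpow_three_mul (by linarith)]
  have t1 := ContinuousLinearMap.le_of_opNorm_le_of_le _ hE hX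
  have t2 := (hσ.tensor ((partialX σ (y u, z u)).comp (y' u) - (partialX σ (y s, z s)).comp (y' s))
    (𝔸 u t)).trans (mul_le_mul (mul_le_mul_of_nonneg_left hζ₀ (by linarith)) hA
      (apply_nonneg N _) (by positivity))
  have t3 := (hσ.tensor ((partialY σ (y u, z u)).comp (z' u) - (partialY σ (y s, z s)).comp (z' s))
    (𝔹 u t)).trans (mul_le_mul (mul_le_mul_of_nonneg_left hζ₁ (by linarith)) hB
      (apply_nonneg N _) (by positivity))
  have T3 : T ^ 3 ≤ T ^ 6 := pow_le_pow_right₀ hT (by norm_num)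
  have T4 : T ^ 4 ≤ T ^ 6 := pow_le_pow_right₀ hT (by norm_num)
  refine (norm_add₃_le.trans (add_le_add (add_le_add t1 t2) t3)).trans ?_
  calc _ = ((T ^ 2 + 3 * T ^ 4 * ε) * Q + 10 * T ^ 6 + T ^ 3 + T ^ 4) * d ^ 3 := by
        rw [hY]; ring
    _ ≤ _ := mul_le_mul_of_nonneg_right (by linarith) (by positivity)

end Germ

/-! ### Estimates for the remainder of a solution -/

section Remainder

variable {U W : Type*} [NormedAddCommGroup U] [NormedSpace ℝ U]
  [NormedAddCommGroup W] [NormedSpace ℝ W]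

/-- `y`, with derivative `y' = σ(y, z)`, is the integral of the germ on `[0, r]`, and its remainder
is Hölder continuous with exponent `2κ`. -/
structure IsGermSolution (σ : W × W → U →L[ℝ] W) (X : ℝ → U) (𝔸 𝔹 : ℝ → ℝ → U ⊗[ℝ] U)
    (z : ℝ → W) (z' : ℝ → U →L[ℝ] W) (y : ℝ → W) (y' : ℝ → U →L[ℝ] W) (r κ : ℝ) : Prop where
  deriv_eq : ∀ s, 0 ≤ s → s ≤ r → y' s = σ (y s, z s)
  integral_eq : ∃ y₀, ∀ x ∈ Icc 0 r, ∀ ε > 0, ∃ δ > 0, ∀ (n : ℕ) (τ : ℕ → ℝ), Monotone τ →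
    τ 0 = 0 → τ n = x → (∀ i < n, τ (i + 1) - τ i < δ) →
    ‖∑ i ∈ Finset.range n, germ σ X 𝔸 𝔹 z z' y y' (τ i) (τ (i + 1)) - (y x - y₀)‖ < ε
  remainder_bounded : ∃ Q, ∀ s t, 0 ≤ s → s < t → t ≤ r →
    ‖remainder X y y' s t‖ ≤ Q * (t - s) ^ (2 * κ)

variable {N : Seminorm ℝ (U ⊗[ℝ] U)} {σ : W × W → U →L[ℝ] W} {X V : ℝ → U}
  {𝔸 𝔹 : ℝ → ℝ → U ⊗[ℝ] U} {z : ℝ → W} {z' : ℝ → U →L[ℝ] W} {y : ℝ → W} {y' : ℝ → U →L[ℝ] W}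
  {r κ T : ℝ}

theorem IsGermSolution.norm_deriv_le (hs : IsGermSolution σ X 𝔸 𝔹 z z' y y' r κ)
    (hσ : CoefficientBound N σ T) {s : ℝ} (h0 : 0 ≤ s) (h1 : s ≤ r) : ‖y' s‖ ≤ T := by
  rw [hs.deriv_eq s h0 h1]; exact hσ.norm_le _

/-- The sewing estimate for a solution: a bound `Q` on the remainder within `[s, t]` reproduces
itself with a gain of `(t - s) ^ κ`. -/
theorem IsGermSolution.norm_remainder_le (hy : IsGermSolution σ X 𝔸 𝔹 z z' y y' r κ)
    (hσ : CoefficientBound N σ T) (h : DataBound N X V 𝔸 𝔹 z z' r κ T) (hκ : 1 < 3 * κ)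
    {s t Q ε : ℝ} (hs : 0 ≤ s) (hst : s < t) (ht : t ≤ r) (hε : (t - s) ^ κ ≤ ε) (hQ0 : 0 ≤ Q)
    (hQ : ∀ a b, s ≤ a → a < b → b ≤ t → ‖remainder X y y' a b‖ ≤ Q * (b - a) ^ (2 * κ)) :
    ‖remainder X y y' s t‖
      ≤ sewingConst (3 * κ) * ((T ^ 2 + 3 * T ^ 4 * ε) * Q + 12 * T ^ 6) * (t - s) ^ (3 * κ)
        + T ^ 3 * (N (𝔸 s t) + N (𝔹 s t)) := by
  have hT := h.one_le
  have hε0 : 0 ≤ ε := (Real.rpow_nonneg (by linarith) _).trans hε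
  obtain ⟨y₀, hI⟩ := hy.integral_eq
  have h1 := norm_integral_sub_germ_le (Ξ := germ σ X 𝔸 𝔹 z z' y y') (Y := fun x => y x - y₀)
    (M := (T ^ 2 + 3 * T ^ 4 * ε) * Q + 12 * T ^ 6) hκ hs hst (by positivity)
    (fun x hx => hI x (by
      rcases hx with rfl | rfl
      · exact ⟨hs, by linarith⟩
      · exact ⟨by linarith, ht⟩))
    (fun a u b ha hau hub hb => norm_germ_defect_le hσ h hy.deriv_eq (hs.trans ha) hau hub
      (hb.trans ht) ((Real.rpow_le_rpow (by linarith) (by linarith) h.exponent_pos.le).trans hε)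
      hQ0 (hQ a u ha hau (by linarith)))
  have e : remainder X y y' s t = (y t - y₀ - (y s - y₀) - germ σ X 𝔸 𝔹 z z' y y' s t)
      + applyTensor ((partialX σ (y s, z s)).comp (y' s)) (𝔸 s t)
      + applyTensor ((partialY σ (y s, z s)).comp (z' s)) (𝔹 s t) := by
    rw [remainder, germ, ← hy.deriv_eq s hs (by linarith)]; abel
  have hfd := hσ.fderiv_le (y s, z s)
  have h2 : ‖applyTensor ((partialX σ (y s, z s)).comp (y' s)) (𝔸 s t)‖ ≤ T ^ 3 * N (𝔸 s t) := by
    have a : ‖(partialX σ (y s, z s)).comp (y' s)‖ ≤ T * T :=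
      (ContinuousLinearMap.opNorm_comp_le _ _).trans (mul_le_mul
        ((norm_partialX_le σ _).trans hfd) (hy.norm_deriv_le hσ hs (by linarith))
        (norm_nonneg _) (by linarith))
    calc _ ≤ T * (T * T) * N (𝔸 s t) := (hσ.tensor _ _).trans (mul_le_mul_of_nonneg_right
          (mul_le_mul_of_nonneg_left a (by linarith)) (apply_nonneg N _))
      _ = _ := by ring
  have h3 : ‖applyTensor ((partialY σ (y s, z s)).comp (z' s)) (𝔹 s t)‖ ≤ T ^ 3 * N (𝔹 s t) := by
    have a : ‖(partialY σ (y s, z s)).comp (z' s)‖ ≤ T * T :=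
      (ContinuousLinearMap.opNorm_comp_le _ _).trans (mul_le_mul
        ((norm_partialY_le σ _).trans hfd) (h.deriv s hs (by linarith))
        (norm_nonneg _) (by linarith))
    calc _ ≤ T * (T * T) * N (𝔹 s t) := (hσ.tensor _ _).trans (mul_le_mul_of_nonneg_right
          (mul_le_mul_of_nonneg_left a (by linarith)) (apply_nonneg N _))
      _ = _ := by ring
  rw [e]
  refine norm_add₃_le.trans ?_
  linarith

theorem rpow_le_one_add_mul {d r a b : ℝ} (hd : 0 < d) (hdr : d ≤ r) (hba : b ≤ a)
    (hab : a ≤ b + 1) : d ^ a ≤ (1 + r) * d ^ b := by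
  have e : d ^ a = d ^ (a - b) * d ^ b := by rw [← Real.rpow_add hd]; ring_nf
  rw [e]
  have h1 : d ^ (a - b) ≤ (1 + r) ^ (a - b) :=
    Real.rpow_le_rpow hd.le (by linarith) (by linarith)
  have h2 : (1 + r) ^ (a - b) ≤ (1 + r) ^ (1 : ℝ) :=
    Real.rpow_le_rpow_of_exponent_le (by linarith) (by linarith)
  rw [Real.rpow_one] at h2
  have := Real.rpow_nonneg hd.le b
  gcongr
  exact h1.trans h2

/-- A solution inherits the regularity of the data: since `3α > 1 ≥ 2β`, the sewing estimate with
exponent `3α` leaves only the areas, which have exponent `2β`. -/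
theorem IsGermSolution.of_exponent_le {α β T' : ℝ} (hy : IsGermSolution σ X 𝔸 𝔹 z z' y y' r α)
    (hσ : CoefficientBound N σ T) (hα : DataBound N X V 𝔸 𝔹 z z' r α T)
    (hβ : DataBound N X V 𝔸 𝔹 z z' r β T') (h1 : 1 < 3 * α) (hαβ : α ≤ β) (h2 : 2 * β ≤ 1) :
    IsGermSolution σ X 𝔸 𝔹 z z' y y' r β := by
  refine ⟨hy.deriv_eq, hy.integral_eq, ?_⟩
  obtain ⟨Q, hQ⟩ := hy.remainder_bounded
  have hT := hα.one_le
  set M := sewingConst (3 * α) * ((T ^ 2 + 3 * T ^ 4 * T) * |Q| + 12 * T ^ 6) with hM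
  have hM0 : 0 ≤ M := by have := (sewingConst_pos h1).le; positivity
  refine ⟨M * (1 + r) + T ^ 3 * (T' + T'), fun s t hs hst ht => ?_⟩
  have hd : 0 < t - s := sub_pos.2 hst
  have h3 := hy.norm_remainder_le hσ hα h1 hs hst ht (hα.rpow_sub_le hs hst ht) (abs_nonneg Q)
    (fun a b ha hab hb => (hQ a b (hs.trans ha) hab (hb.trans ht)).trans
      (mul_le_mul_of_nonneg_right (le_abs_self Q) (Real.rpow_nonneg (by linarith) _)))
  have h4 : (t - s) ^ (3 * α) ≤ (1 + r) * (t - s) ^ (2 * β) :=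
    rpow_le_one_add_mul hd (by linarith) (by linarith) (by linarith)
  have h5 := hβ.area s t hs hst ht
  have h6 := hβ.delayedArea s t hs hst ht
  calc _ ≤ M * ((1 + r) * (t - s) ^ (2 * β))
        + T ^ 3 * (T' * (t - s) ^ (2 * β) + T' * (t - s) ^ (2 * β)) := h3.trans (by gcongr)
    _ = _ := by ring

/-- The bound on the remainder over short intervals: on intervals so short that the
gain in the sewing estimate beats the constants, the finite but unknown Hölder constant of the
remainder is absorbed into the left-hand side. -/
theorem IsGermSolution.norm_remainder_le_of_short (hy : IsGermSolution σ X 𝔸 𝔹 z z' y y' r κ)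
    (hσ : CoefficientBound N σ T) (h : DataBound N X V 𝔸 𝔹 z z' r κ T) (hκ : 1 < 3 * κ)
    (hK : sewingConst (3 * κ) ≤ T) {ℓ : ℝ} (hℓ : ℓ ^ κ ≤ (4 * T ^ 3)⁻¹)
    {s t : ℝ} (hs : 0 ≤ s) (hst : s < t) (ht : t ≤ r) (hstℓ : t - s ≤ ℓ) :
    ‖remainder X y y' s t‖ ≤ 10 * T ^ 4 * (t - s) ^ (2 * κ) := by
  have hT := h.one_le
  obtain ⟨Q₀, hQ₀⟩ := hy.remainder_bounded
  set S : Set ℝ := {c | ∃ s t, 0 ≤ s ∧ s < t ∧ t ≤ r ∧ t - s ≤ ℓ ∧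
    c = ‖remainder X y y' s t‖ / (t - s) ^ (2 * κ)} with hS
  have hSb : BddAbove S := ⟨Q₀, by
    rintro c ⟨a, b, ha, hab, hb, -, rfl⟩
    rw [div_le_iff₀ (Real.rpow_pos_of_pos (sub_pos.2 hab) _)]
    exact hQ₀ a b ha hab hb⟩
  set Q := sSup S with hQ
  have hQ0 : 0 ≤ Q := Real.sSup_nonneg (by
    rintro c ⟨a, b, ha, hab, hb, -, rfl⟩
    exact div_nonneg (norm_nonneg _) (Real.rpow_nonneg (by linarith) _))
  have hrem : ∀ a b, 0 ≤ a → a < b → b ≤ r → b - a ≤ ℓ →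
      ‖remainder X y y' a b‖ ≤ Q * (b - a) ^ (2 * κ) := fun a b ha hab hb hl => by
    rw [← div_le_iff₀ (Real.rpow_pos_of_pos (sub_pos.2 hab) _)]
    exact le_csSup hSb ⟨a, b, ha, hab, hb, hl, rfl⟩
  set ε : ℝ := (4 * T ^ 3)⁻¹ with hε
  have hε0 : 0 ≤ ε := by positivity
  have e1 : T ^ 3 * ε = 1 / 4 := by rw [hε]; field_simp
  have hQle : Q ≤ 10 * T ^ 4 := by
    have key : Q ≤ Q / 2 + 5 * T ^ 4 := by
      refine Real.sSup_le ?_ (by positivity)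
      rintro c ⟨a, b, ha, hab, hb, hl, rfl⟩
      have hd : 0 < b - a := sub_pos.2 hab
      have hdε : (b - a) ^ κ ≤ ε :=
        (Real.rpow_le_rpow hd.le hl h.exponent_pos.le).trans hℓ
      have hd0 : 0 ≤ (b - a) ^ κ := Real.rpow_nonneg hd.le _
      rw [div_le_iff₀ (Real.rpow_pos_of_pos hd _)]
      have h3 := hy.norm_remainder_le hσ h hκ ha hab hb hdε hQ0
        (fun a' b' ha' hab' hb' => hrem a' b' (ha.trans ha') hab' (hb'.trans hb) (by linarith))
      have h5 := h.area a b ha hab hb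
      have h6 := h.delayedArea a b ha hab hb
      rw [rpow_two_mul hd.le] at h5 h6 ⊢
      rw [rpow_three_mul hd.le] at h3
      set d := (b - a) ^ κ with hd'
      have hd3 : d ^ 3 ≤ ε * d ^ 2 := by
        rw [pow_succ' d 2]; gcongr
      have hTT : T ^ 5 * ε * ε ≤ 1 / 16 := by
        have : T ^ 5 * ε * ε * T = 1 / 16 := by
          calc _ = (T ^ 3 * ε) * (T ^ 3 * ε) := by ring
            _ = _ := by rw [e1]; norm_num
        have h0 : 0 ≤ T ^ 5 * ε * ε := by positivity
        nlinarith
      calc _ ≤ T * ((T ^ 2 + 3 * T ^ 4 * ε) * Q + 12 * T ^ 6) * (ε * d ^ 2)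
            + T ^ 3 * (T * d ^ 2 + T * d ^ 2) := h3.trans (by gcongr)
        _ = ((T ^ 3 * ε + 3 * (T ^ 5 * ε * ε)) * Q + 12 * T ^ 4 * (T ^ 3 * ε) + 2 * T ^ 4)
            * d ^ 2 := by ring
        _ ≤ ((1 / 4 + 3 * (1 / 16)) * Q + 12 * T ^ 4 * (1 / 4) + 2 * T ^ 4) * d ^ 2 := by
          rw [e1]; gcongr
        _ ≤ (Q / 2 + 5 * T ^ 4) * d ^ 2 := mul_le_mul_of_nonneg_right (by linarith) (by positivity)
    linarith
  exact (hrem s t hs hst ht hstℓ).trans (mul_le_mul_of_nonneg_right hQle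
    (Real.rpow_nonneg (by linarith) _))

end Remainder

/-! ### From short intervals to the whole interval -/

section Global

theorem norm_sub_le_of_short {E : Type*} [SeminormedAddCommGroup E] {f : ℝ → E} {r D : ℝ} {n : ℕ}
    (hn : 0 < n)
    (hf : ∀ s t, 0 ≤ s → s < t → t ≤ r → t - s ≤ r / n → ‖f t - f s‖ ≤ D)
    {s t : ℝ} (hs : 0 ≤ s) (hst : s < t) (ht : t ≤ r) : ‖f t - f s‖ ≤ n * D := by
  have hn' : (0 : ℝ) < n := by exact_mod_cast hn
  have hd : 0 < t - s := sub_pos.2 hst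
  have h := dist_le_range_sum_of_dist_le (f := fun i : ℕ => f (s + (t - s) * (i / n)))
    (d := fun _ => D) n (fun {i} hi => by
      have hi' : ((i : ℝ) + 1) / n ≤ 1 := by rw [div_le_one hn']; exact_mod_cast hi
      have e : (t - s) * (((i : ℝ) + 1) / n) = (t - s) * (i / n) + (t - s) / n := by ring
      have h0 : 0 < (t - s) / n := by positivity
      have h1 : 0 ≤ (t - s) * ((i : ℝ) / n) := by positivity
      have h2 : (t - s) / n ≤ r / n := by gcongr; linarith
      have h3 : (t - s) * (((i : ℝ) + 1) / n) ≤ t - s := mul_le_of_le_one_right hd.le hi'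
      rw [dist_comm, dist_eq_norm]
      push_cast
      exact hf _ _ (by linarith) (by linarith) (by linarith) (by linarith))
  rw [dist_comm, dist_eq_norm] at h
  simpa [div_self hn'.ne'] using h

variable {U W : Type*} [NormedAddCommGroup U] [NormedSpace ℝ U]
  [NormedAddCommGroup W] [NormedSpace ℝ W]
  {N : Seminorm ℝ (U ⊗[ℝ] U)} {σ : W × W → U →L[ℝ] W} {X V : ℝ → U}
  {𝔸 𝔹 : ℝ → ℝ → U ⊗[ℝ] U} {z : ℝ → W} {z' : ℝ → U →L[ℝ] W} {y : ℝ → W} {y' : ℝ → U →L[ℝ] W}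
  {r κ T : ℝ}

/-- The bound on the remainder over `[0, r]`. An interval of length `(4 * T ^ 3) ^ (-3)` is short
enough since `1 / κ < 3`, so that polynomially many short intervals cover `[0, r]`; the bound over
each of them does not depend on the others since `σ` is bounded. -/
theorem IsGermSolution.norm_remainder_le_global (hy : IsGermSolution σ X 𝔸 𝔹 z z' y y' r κ)
    (hσ : CoefficientBound N σ T) (h : DataBound N X V 𝔸 𝔹 z z' r κ T) (hκ : 1 < 3 * κ)
    (hκ2 : 2 * κ ≤ 1) (hK : sewingConst (3 * κ) ≤ T) (hr : 0 < r) (hrT : r ≤ T) (hrT' : r⁻¹ ≤ T)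
    {s t : ℝ} (hs : 0 ≤ s) (hst : s < t) (ht : t ≤ r) :
    ‖remainder X y y' s t‖ ≤ 50000 * T ^ 25 * (t - s) ^ (2 * κ) := by
  have hT := h.one_le
  have hT0 : 0 < T := by linarith
  have pow_le : ∀ {i j : ℕ}, i ≤ j → T ^ i ≤ T ^ j := fun hij => pow_le_pow_right₀ hT hij
  -- With `n` steps, the step length `r / n` is at most `(4 * T ^ 3) ^ (-3)`.
  set n : ℕ := ⌈r * (4 * T ^ 3) ^ 3⌉₊ + 1 with hn
  have hnpos : (0 : ℝ) < n := by positivity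
  have hn1 : r * (4 * T ^ 3) ^ 3 ≤ n := (Nat.le_ceil _).trans (by rw [hn]; push_cast; linarith)
  have hn2 : (n : ℝ) ≤ 66 * T ^ 10 := by
    have a : (⌈r * (4 * T ^ 3) ^ 3⌉₊ : ℝ) < r * (4 * T ^ 3) ^ 3 + 1 :=
      Nat.ceil_lt_add_one (by positivity)
    have b : r * (4 * T ^ 3) ^ 3 ≤ T * (4 * T ^ 3) ^ 3 := by gcongr
    have c : (1 : ℝ) ≤ T ^ 10 := one_le_pow₀ hT
    have e : T * (4 * T ^ 3) ^ 3 = 64 * T ^ 10 := by ring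
    rw [hn]; push_cast; linarith
  have hstep0 : 0 < r / n := by positivity
  have h4T : 1 ≤ 4 * T ^ 3 := by
    have : 1 ≤ T ^ 3 := one_le_pow₀ hT
    linarith
  have hinv0 : 0 < (4 * T ^ 3)⁻¹ := by positivity
  have hinv1 : (4 * T ^ 3)⁻¹ ≤ 1 := inv_le_one_of_one_le₀ h4T
  have hstep : r / n ≤ (4 * T ^ 3)⁻¹ ^ 3 := by
    rw [div_le_iff₀ hnpos, inv_pow, inv_mul_eq_div, le_div_iff₀ (by positivity)]
    exact hn1
  have hstep1 : r / n ≤ 1 := hstep.trans (pow_le_one₀ hinv0.le hinv1)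
  have hstepκ : (r / n) ^ κ ≤ (4 * T ^ 3)⁻¹ := by
    calc (r / n) ^ κ ≤ ((4 * T ^ 3)⁻¹ ^ 3) ^ κ :=
          Real.rpow_le_rpow hstep0.le hstep h.exponent_pos.le
      _ = (4 * T ^ 3)⁻¹ ^ (3 * κ) := by
          rw [Real.rpow_mul hinv0.le]; norm_cast
      _ ≤ (4 * T ^ 3)⁻¹ ^ (1 : ℝ) :=
          Real.rpow_le_rpow_of_exponent_ge hinv0 hinv1 hκ.le
      _ = _ := Real.rpow_one _
  have hshort : ∀ a b, 0 ≤ a → a < b → b ≤ r → b - a ≤ r / n →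
      ‖remainder X y y' a b‖ ≤ 10 * T ^ 4 * (b - a) ^ (2 * κ) := fun a b ha hab hb hl =>
    hy.norm_remainder_le_of_short hσ h hκ hK hstepκ ha hab hb hl
  rcases le_or_gt (t - s) (r / n) with hl | hl
  · refine (hshort s t hs hst ht hl).trans (mul_le_mul_of_nonneg_right ?_
      (Real.rpow_nonneg (by linarith) _))
    have a := pow_le (show 4 ≤ 25 by norm_num)
    have b : 0 < T ^ 25 := by positivity
    linarith
  · have hincr : ‖y t - y s‖ ≤ n * (11 * T ^ 4) := by
      refine norm_sub_le_of_short (by omega) (fun a b ha hab hb hl => ?_) hs hst ht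
      have c := h.norm_solution_sub_le ha hab hb (hy.norm_deriv_le hσ ha (by linarith))
        (hshort a b ha hab hb hl)
      have d1 : (b - a) ^ κ ≤ 1 :=
        ((Real.rpow_le_rpow (by linarith) hl h.exponent_pos.le).trans hstepκ).trans hinv1
      have d0 : 0 ≤ (b - a) ^ κ := Real.rpow_nonneg (by linarith) _
      calc _ ≤ T ^ 2 * 1 + 10 * T ^ 4 * 1 ^ 2 := c.trans (by gcongr)
        _ ≤ 11 * T ^ 4 := by have := pow_le (show 2 ≤ 4 by norm_num); linarith
    have hX : ‖y' s (X t - X s)‖ ≤ T * (T * T) :=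
      ContinuousLinearMap.le_of_opNorm_le_of_le _ (hy.norm_deriv_le hσ hs (by linarith))
        ((h.signal s t hs hst ht).trans
          (mul_le_mul_of_nonneg_left (h.rpow_sub_le hs hst ht) hT0.le))
    have hrem : ‖remainder X y y' s t‖ ≤ 727 * T ^ 14 := by
      rw [remainder]
      refine (_root_.norm_sub_le _ _).trans ((add_le_add hincr hX).trans ?_)
      calc n * (11 * T ^ 4) + T * (T * T) ≤ 66 * T ^ 10 * (11 * T ^ 4) + T * (T * T) := by gcongr
        _ = 726 * T ^ 14 + T ^ 3 := by ring
        _ ≤ _ := by have := pow_le (show 3 ≤ 14 by norm_num); linarith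
    have hlow : 1 ≤ 66 * T ^ 11 * (t - s) ^ (2 * κ) := by
      have a : r / n ≤ (t - s) ^ (2 * κ) := by
        calc r / n = (r / n) ^ (1 : ℝ) := (Real.rpow_one _).symm
          _ ≤ (r / n) ^ (2 * κ) := Real.rpow_le_rpow_of_exponent_ge hstep0 hstep1 hκ2
          _ ≤ _ := Real.rpow_le_rpow hstep0.le hl.le (by linarith)
      have b : 1 ≤ T * r := by rwa [inv_le_iff_one_le_mul₀ hr] at hrT'
      have c : 1 ≤ 66 * T ^ 11 * (r / n) := by
        rw [mul_div_assoc', le_div_iff₀ hnpos, one_mul]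
        calc (n : ℝ) ≤ 66 * T ^ 10 * 1 := by linarith
          _ ≤ 66 * T ^ 10 * (T * r) := by gcongr
          _ = _ := by ring
      exact c.trans (by gcongr)
    have h0 : 0 ≤ (t - s) ^ (2 * κ) := Real.rpow_nonneg (by linarith) _
    calc ‖remainder X y y' s t‖ ≤ 727 * T ^ 14 * 1 := by linarith
      _ ≤ 727 * T ^ 14 * (66 * T ^ 11 * (t - s) ^ (2 * κ)) := by gcongr
      _ = 47982 * T ^ 25 * (t - s) ^ (2 * κ) := by ring
      _ ≤ _ := by gcongr; norm_num

end Global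

/-! ### Hölder seminorms and the controlled norm -/

section Holder

theorem HolderFinite.le_holderSeminorm_mul {α : ℝ} {I : Set ℝ} {q : ℝ → ℝ → ℝ}
    (h : HolderFinite α I q) {s t : ℝ} (hs : s ∈ I) (ht : t ∈ I) (hst : s < t) :
    q s t ≤ holderSeminorm α I q * (t - s) ^ α := by
  have hd : 0 < t - s := sub_pos.2 hst
  rw [← div_le_iff₀ (Real.rpow_pos_of_pos hd _)]
  exact le_csSup h ⟨s, hs, t, ht, hst.ne, by rw [abs_of_pos hd]⟩

theorem holderSeminorm_nonneg {α : ℝ} {I : Set ℝ} {q : ℝ → ℝ → ℝ} (hq : ∀ s t, 0 ≤ q s t) :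
    0 ≤ holderSeminorm α I q :=
  Real.sSup_nonneg (by
    rintro c ⟨s, -, t, -, -, rfl⟩
    exact div_nonneg (hq s t) (Real.rpow_nonneg (abs_nonneg _) _))

theorem holderFinite_and_holderSeminorm_le {α a b C : ℝ} {q : ℝ → ℝ → ℝ} (hC : 0 ≤ C)
    (h : ∀ s t, a ≤ s → s < t → t ≤ b → q s t ≤ C * (t - s) ^ α ∧ q t s ≤ C * (t - s) ^ α) :
    HolderFinite α (Icc a b) q ∧ holderSeminorm α (Icc a b) q ≤ C := by
  have key : ∀ c ∈ holderQuotients α (Icc a b) q, c ≤ C := by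
    rintro c ⟨s, hs, t, ht, hne, rfl⟩
    rw [div_le_iff₀ (Real.rpow_pos_of_pos (abs_pos.2 (sub_ne_zero.2 hne.symm)) _)]
    rcases lt_or_gt_of_ne hne with hlt | hlt
    · rw [abs_of_pos (sub_pos.2 hlt)]
      exact (h s t hs.1 hlt ht.2).1
    · rw [abs_sub_comm, abs_of_pos (sub_pos.2 hlt)]
      exact (h t s ht.1 hlt hs.2).2
  exact ⟨⟨C, key⟩, Real.sSup_le key hC⟩

variable {U W : Type*} [NormedAddCommGroup U] [NormedSpace ℝ U]
  [NormedAddCommGroup W] [NormedSpace ℝ W]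
  {N : Seminorm ℝ (U ⊗[ℝ] U)} {σ : W × W → U →L[ℝ] W} {X V : ℝ → U}
  {𝔸 𝔹 : ℝ → ℝ → U ⊗[ℝ] U} {z : ℝ → W} {z' : ℝ → U →L[ℝ] W} {y : ℝ → W} {y' : ℝ → U →L[ℝ] W}
  {r κ T : ℝ}

/-- The bound on the remainder controls the whole controlled norm of a solution, whose derivative
`σ(y, z)` is bounded and a Lipschitz function of `(y, z)`. -/
theorem IsGermSolution.controlledNorm_le (hy : IsGermSolution σ X 𝔸 𝔹 z z' y y' r κ)
    (hσ : CoefficientBound N σ T) (h : DataBound N X V 𝔸 𝔹 z z' r κ T) (hκ : 1 < 3 * κ)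
    (hκ2 : 2 * κ ≤ 1) (hK : sewingConst (3 * κ) ≤ T) (hr : 0 < r) (hrT : r ≤ T) (hrT' : r⁻¹ ≤ T)
    (hy0 : y 0 = z r) (hz0 : ‖z 0‖ ≤ T) :
    IsControlled X κ 0 r y y' ∧ controlledNorm X κ 0 r y y' ≤ 200000 * T ^ 28 := by
  have hT := h.one_le
  have hT0 : 0 < T := by linarith
  have pow_le : ∀ {i j : ℕ}, i ≤ j → T ^ i ≤ T ^ j := fun hij => pow_le_pow_right₀ hT hij
  have hrem := fun s t hs hst ht => hy.norm_remainder_le_global (s := s) (t := t) hσ h hκ hκ2 hK hr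
    hrT hrT' hs hst ht
  have hderiv : ∀ s t, 0 ≤ s → s < t → t ≤ r →
      ‖y' t - y' s‖ ≤ 50002 * T ^ 27 * (t - s) ^ κ := fun s t hs hst ht => by
    have hd := h.rpow_sub_le hs hst ht
    have hd0 : 0 ≤ (t - s) ^ κ := Real.rpow_nonneg (by linarith) _
    have h2 := pow_le (show 2 ≤ 26 by norm_num)
    have h26 : 0 < T ^ 26 := by positivity
    have hp : ‖(y t, z t) - (y s, z s)‖ ≤ 50002 * T ^ 26 * (t - s) ^ κ := by
      rw [Prod.mk_sub_mk, Prod.norm_mk]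
      refine max_le ((h.norm_solution_sub_le hs hst ht (hy.norm_deriv_le hσ hs (by linarith))
        (hrem s t hs hst ht)).trans ?_) ((h.norm_sub_le hs hst ht).trans ?_)
      · calc _ ≤ T ^ 2 * (t - s) ^ κ + 50000 * T ^ 25 * ((t - s) ^ κ * T) := by
              rw [sq ((t - s) ^ κ)]; gcongr
          _ = (T ^ 2 + 50000 * T ^ 26) * (t - s) ^ κ := by ring
          _ ≤ _ := mul_le_mul_of_nonneg_right (by linarith) hd0
      · exact mul_le_mul_of_nonneg_right (by linarith) hd0
    rw [hy.deriv_eq s hs (by linarith), hy.deriv_eq t (by linarith) ht]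
    calc _ ≤ T * (50002 * T ^ 26 * (t - s) ^ κ) := (hσ.lipschitz _ _).trans (by gcongr)
      _ = _ := by ring
  have hrem' : ∀ s t, 0 ≤ s → s < t → t ≤ r →
      ‖remainder X y y' t s‖ ≤ 100002 * T ^ 28 * (t - s) ^ (2 * κ) := fun s t hs hst ht => by
    -- Reversing the order of the two times costs an increment of `y'` times an increment of `X`.
    have e : remainder X y y' t s = -remainder X y y' s t + (y' t - y' s) (X t - X s) := by
      simp only [remainder, sub_apply, map_sub]; abel
    have a := hrem s t hs hst ht
    have b : ‖(y' t - y' s) (X t - X s)‖ ≤ 50002 * T ^ 27 * (t - s) ^ κ * (T * (t - s) ^ κ) :=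
      ContinuousLinearMap.le_of_opNorm_le_of_le _ (hderiv s t hs hst ht) (h.signal s t hs hst ht)
    rw [rpow_two_mul (by linarith)] at a ⊢
    have c := pow_le (show 25 ≤ 28 by norm_num)
    rw [e]
    calc _ ≤ 50000 * T ^ 25 * ((t - s) ^ κ) ^ 2
          + 50002 * T ^ 27 * (t - s) ^ κ * (T * (t - s) ^ κ) :=
          (norm_add_le _ _).trans (by rw [norm_neg]; linarith)
      _ = (50000 * T ^ 25 + 50002 * T ^ 28) * ((t - s) ^ κ) ^ 2 := by ring
      _ ≤ _ := mul_le_mul_of_nonneg_right (by linarith) (by positivity)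
  obtain ⟨f1, g1⟩ := holderFinite_and_holderSeminorm_le (α := κ) (a := 0) (b := r) (q := incr y')
    (C := 50002 * T ^ 27) (by positivity) (fun s t hs hst ht => ⟨hderiv s t hs hst ht, by
      rw [incr, norm_sub_rev]; exact hderiv s t hs hst ht⟩)
  obtain ⟨f2, g2⟩ := holderFinite_and_holderSeminorm_le (α := 2 * κ) (a := 0) (b := r)
    (q := fun s t => ‖remainder X y y' s t‖)
    (C := 100002 * T ^ 28) (by positivity) (fun s t hs hst ht => ⟨(hrem s t hs hst ht).trans
      (mul_le_mul_of_nonneg_right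
        (by have := pow_le (show 25 ≤ 28 by norm_num)
            have : 0 < T ^ 28 := by positivity
            linarith)
        (Real.rpow_nonneg (by linarith) _)), hrem' s t hs hst ht⟩)
  refine ⟨⟨f1, f2⟩, ?_⟩
  have hy0' : ‖y 0‖ ≤ T + 2 * T ^ 2 * T := by
    have a := h.norm_sub_le le_rfl hr le_rfl
    have b := h.rpow_sub_le le_rfl hr le_rfl
    calc ‖y 0‖ = ‖z 0 + (z r - z 0)‖ := by rw [hy0, add_sub_cancel]
      _ ≤ T + 2 * T ^ 2 * (r - 0) ^ κ := (norm_add_le _ _).trans (add_le_add hz0 a)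
      _ ≤ _ := by gcongr
  have hy'0 := hy.norm_deriv_le hσ le_rfl hr.le
  have p1 : T ≤ T ^ 28 := le_self_pow₀ hT (by norm_num)
  have p3 := pow_le (show 3 ≤ 28 by norm_num)
  have p27 := pow_le (show 27 ≤ 28 by norm_num)
  have e3 : 2 * T ^ 2 * T = 2 * T ^ 3 := by ring
  rw [controlledNorm]
  linarith

end Holder

/-! ### The rough delay equation -/

section Delay

variable {U W : Type*} [NormedAddCommGroup U] [NormedSpace ℝ U]
  [NormedAddCommGroup W] [NormedSpace ℝ W]
  {N : Seminorm ℝ (U ⊗[ℝ] U)} {r β γ : ℝ}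

theorem controlledNorm_nonneg (X : ℝ → U) (β a b : ℝ) (m : ℝ → W) (m' : ℝ → U →L[ℝ] W) :
    0 ≤ controlledNorm X β a b m m' := by
  have h1 : 0 ≤ holderSeminorm β (Icc a b) (incr m') :=
    holderSeminorm_nonneg fun s t => norm_nonneg _
  have h2 : 0 ≤ holderSeminorm (2 * β) (Icc a b) (fun s t => ‖remainder X m m' s t‖) :=
    holderSeminorm_nonneg fun s t => norm_nonneg _
  rw [controlledNorm]; positivity

theorem DelayedRoughPath.norm_nonneg (𝓧 : DelayedRoughPath N r γ) (a b : ℝ) : 0 ≤ 𝓧.norm a b := by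
  have h1 : ∀ I : Set ℝ, 0 ≤ holderSeminorm γ I (incr 𝓧.path) := fun I =>
    holderSeminorm_nonneg fun s t => _root_.norm_nonneg _
  have h2 := h1 (Icc a b)
  have h3 := h1 (Icc (a - r) (b - r))
  rw [DelayedRoughPath.norm]; positivity

/-- All data of the delay equation are bounded by a multiple of `((1 + ‖𝓧‖) (1 + ‖ξ‖)) ^ 2`, with
any exponent up to `β`. The square is needed because the areas enter `‖𝓧‖` through square roots. -/
theorem IsControlled.dataBound {𝓧 : DelayedRoughPath N r γ} {ξ : ℝ → W} {ξ' : ℝ → U →L[ℝ] W}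
    (hξ : IsControlled 𝓧.path β (-r) 0 ξ ξ') {y : ℝ → W} (hy : ∀ t ∈ Icc (-r) 0, y t = ξ t)
    (hr : 0 < r) (hβγ : β < γ) (hγ : γ ≤ 1 / 2) {κ : ℝ} (hκ : 0 < κ) (hκβ : κ ≤ β) {L : ℝ}
    (hL : 2 + r ≤ L) :
    DataBound N 𝓧.path (fun s => 𝓧.path (s - r)) 𝓧.area 𝓧.delayedArea (fun s => y (s - r))
      (fun s => ξ' (s - r)) r κ
      (L * ((1 + 𝓧.norm 0 r) * (1 + controlledNorm 𝓧.path β (-r) 0 ξ ξ')) ^ 2) := by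
  set A := 1 + 𝓧.norm 0 r with hA
  set R := controlledNorm 𝓧.path β (-r) 0 ξ ξ' with hR
  have hA1 : 1 ≤ A := by linarith [𝓧.norm_nonneg 0 r]
  have hR0 : 0 ≤ R := controlledNorm_nonneg _ _ _ _ _ _
  have hAa : A ≤ A * (1 + R) := le_mul_of_one_le_right (by linarith) (by linarith)
  have hRa : R ≤ A * (1 + R) := by nlinarith
  have ha1 : 1 ≤ A * (1 + R) := hA1.trans hAa
  have haa : A * (1 + R) ≤ (A * (1 + R)) ^ 2 := le_self_pow₀ ha1 two_ne_zero
  have hAA : A ^ 2 ≤ (A * (1 + R)) ^ 2 := by gcongr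
  set a := (A * (1 + R)) ^ 2 with ha
  have ha1' : 1 ≤ a := ha1.trans haa
  have s1 : 0 ≤ holderSeminorm γ (Icc 0 r) (incr 𝓧.path) :=
    holderSeminorm_nonneg fun s t => _root_.norm_nonneg _
  have s2 : 0 ≤ holderSeminorm γ (Icc (0 - r) (r - r)) (incr 𝓧.path) :=
    holderSeminorm_nonneg fun s t => _root_.norm_nonneg _
  have s3 : 0 ≤ holderSeminorm (2 * γ) (Icc 0 r) (fun s t => N (𝓧.area s t)) :=
    holderSeminorm_nonneg fun s t => apply_nonneg N _
  have s4 : 0 ≤ holderSeminorm (2 * γ) (Icc 0 r) (fun s t => N (𝓧.delayedArea s t)) :=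
    holderSeminorm_nonneg fun s t => apply_nonneg N _
  have s5 : 0 ≤ holderSeminorm β (Icc (-r) 0) (incr ξ') :=
    holderSeminorm_nonneg fun s t => _root_.norm_nonneg _
  have s6 : 0 ≤ holderSeminorm (2 * β) (Icc (-r) 0) (fun s t => ‖remainder 𝓧.path ξ ξ' s t‖) :=
    holderSeminorm_nonneg fun s t => _root_.norm_nonneg _
  have hAdef : A = 1 + (holderSeminorm γ (Icc 0 r) (incr 𝓧.path)
    + holderSeminorm γ (Icc (0 - r) (r - r)) (incr 𝓧.path)
    + √(holderSeminorm (2 * γ) (Icc 0 r) (fun s t => N (𝓧.area s t)))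
    + √(holderSeminorm (2 * γ) (Icc 0 r) (fun s t => N (𝓧.delayedArea s t)))) := rfl
  have hRdef : R = ‖ξ (-r)‖ + ‖ξ' (-r)‖ + holderSeminorm β (Icc (-r) 0) (incr ξ')
    + holderSeminorm (2 * β) (Icc (-r) 0) (fun s t => ‖remainder 𝓧.path ξ ξ' s t‖) := rfl
  have n1 := _root_.norm_nonneg (ξ (-r))
  have n2 := _root_.norm_nonneg (ξ' (-r))
  have q3 := Real.sqrt_nonneg (holderSeminorm (2 * γ) (Icc 0 r) (fun s t => N (𝓧.area s t)))
  have q4 := Real.sqrt_nonneg (holderSeminorm (2 * γ) (Icc 0 r) (fun s t => N (𝓧.delayedArea s t)))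
  have b1 : holderSeminorm γ (Icc 0 r) (incr 𝓧.path) ≤ a := by linarith
  have b2 : holderSeminorm γ (Icc (0 - r) (r - r)) (incr 𝓧.path) ≤ a := by linarith
  have b3 : holderSeminorm (2 * γ) (Icc 0 r) (fun s t => N (𝓧.area s t)) ≤ a := by
    refine le_trans ?_ hAA
    rw [← Real.sqrt_le_left (by linarith)]; linarith
  have b4 : holderSeminorm (2 * γ) (Icc 0 r) (fun s t => N (𝓧.delayedArea s t)) ≤ a := by
    refine le_trans ?_ hAA
    rw [← Real.sqrt_le_left (by linarith)]; linarith
  have b5 : holderSeminorm β (Icc (-r) 0) (incr ξ') ≤ a := by linarith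
  have b6 : holderSeminorm (2 * β) (Icc (-r) 0) (fun s t => ‖remainder 𝓧.path ξ ξ' s t‖) ≤ a := by
    linarith
  have scale : ∀ {s t c e b : ℝ}, 0 ≤ s → s < t → t ≤ r → c ≤ a → b ≤ e → e ≤ b + 1 →
      c * (t - s) ^ e ≤ L * a * (t - s) ^ b := by
    intro s t c e b hs hst ht hc hbe heb
    have h1 := rpow_le_one_add_mul (sub_pos.2 hst) (show t - s ≤ r by linarith) hbe heb
    have h2 : 0 ≤ (t - s) ^ e := Real.rpow_nonneg (by linarith) _
    have h3 : 0 ≤ (t - s) ^ b := Real.rpow_nonneg (by linarith) _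
    calc c * (t - s) ^ e ≤ a * ((1 + r) * (t - s) ^ b) := by gcongr
      _ = (1 + r) * a * (t - s) ^ b := by ring
      _ ≤ _ := by gcongr; linarith
  have mem : ∀ {s : ℝ}, 0 ≤ s → s ≤ r → s - r ∈ Icc (-r) 0 := fun h0 h1 =>
    ⟨by linarith, by linarith⟩
  refine ⟨hκ, ?_, ?_, ?_, ?_, ?_, ?_, 𝓧.area_chen, 𝓧.delayedArea_chen, ?_, ?_, ?_⟩
  · nlinarith
  · have := rpow_le_one_add_mul hr le_rfl hκ.le (b := 0) (by linarith)
    rw [Real.rpow_zero, mul_one] at this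
    nlinarith
  · intro s t hs hst ht
    exact ((𝓧.path_holder 0 r).le_holderSeminorm_mul ⟨hs, by linarith⟩ ⟨by linarith, ht⟩ hst).trans
      (scale hs hst ht b1 (by linarith) (by linarith))
  · intro s t hs hst ht
    have := (𝓧.path_holder (0 - r) (r - r)).le_holderSeminorm_mul (s := s - r) (t := t - r)
      ⟨by linarith, by linarith⟩ ⟨by linarith, by linarith⟩ (by linarith)
    rw [sub_sub_sub_cancel_right] at this
    exact this.trans (scale hs hst ht b2 (by linarith) (by linarith))
  · intro s t hs hst ht
    exact ((𝓧.area_holder 0 r).le_holderSeminorm_mul ⟨hs, by linarith⟩ ⟨by linarith, ht⟩ hst).trans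
      (scale hs hst ht b3 (by linarith) (by linarith))
  · intro s t hs hst ht
    exact ((𝓧.delayedArea_holder 0 r).le_holderSeminorm_mul ⟨hs, by linarith⟩
      ⟨by linarith, ht⟩ hst).trans (scale hs hst ht b4 (by linarith) (by linarith))
  · intro s hs hsr
    rcases hs.eq_or_lt with rfl | hs0
    · rw [zero_sub]; nlinarith
    · have h1 := hξ.deriv_holder.le_holderSeminorm_mul (s := -r) (t := s - r)
        ⟨le_rfl, by linarith⟩ (mem hs hsr) (by linarith)
      rw [sub_neg_eq_add, sub_add_cancel, incr] at h1
      have h2 := rpow_le_one_add_mul hs0 hsr (a := β) (b := 0) (by linarith) (by linarith)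
      rw [Real.rpow_zero, mul_one] at h2
      calc ‖ξ' (s - r)‖ = ‖ξ' (-r) + (ξ' (s - r) - ξ' (-r))‖ := by rw [add_sub_cancel]
        _ ≤ a + a * (1 + r) := (norm_add_le _ _).trans (add_le_add (by linarith)
            (h1.trans (by gcongr)))
        _ = (2 + r) * a := by ring
        _ ≤ _ := by gcongr
  · intro s t hs hst ht
    have := hξ.deriv_holder.le_holderSeminorm_mul (mem hs (by linarith))
      (mem (by linarith : 0 ≤ t) ht) (by linarith)
    rw [sub_sub_sub_cancel_right] at this
    exact this.trans (scale hs hst ht b5 (by linarith) (by linarith))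
  · intro s t hs hst ht
    have := hξ.remainder_holder.le_holderSeminorm_mul (mem hs (by linarith))
      (mem (by linarith : 0 ≤ t) ht) (by linarith)
    rw [sub_sub_sub_cancel_right] at this
    simp only [hy _ (mem hs (by linarith)), hy _ (mem (by linarith : 0 ≤ t) ht)]
    exact this.trans (scale hs hst ht b6 (by linarith) (by linarith))

theorem IsSolution.isGermSolution {𝓧 : DelayedRoughPath N r γ} {σ : W × W → U →L[ℝ] W} {α : ℝ}
    {ξ y : ℝ → W} {ξ' y' : ℝ → U →L[ℝ] W} (h : IsSolution 𝓧 σ α ξ ξ' y y') :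
    IsGermSolution σ 𝓧.path 𝓧.area 𝓧.delayedArea (fun s => y (s - r)) (fun s => ξ' (s - r)) y y'
      r α where
  deriv_eq s h0 h1 := h.deriv_eq s ⟨h0, h1⟩
  integral_eq := ⟨ξ 0, h.integral_eq⟩
  remainder_bounded := ⟨_, fun _ _ h0 h1 h2 =>
    h.controlled.remainder_holder.le_holderSeminorm_mul ⟨h0, by linarith⟩ ⟨by linarith, h2⟩ h1⟩

end Delay

theorem mainTheorem9 {U W : Type*}
    [NormedAddCommGroup U] [NormedSpace ℝ U] [FiniteDimensional ℝ U]
    [NormedAddCommGroup W] [NormedSpace ℝ W] [FiniteDimensional ℝ W]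
    (N : Seminorm ℝ (TensorProduct ℝ U U)) (hN : ∀ z, N z = 0 → z = 0)
    (r β γ : ℝ) (hr : 0 < r) (hβ : 1 / 3 < β) (hβγ : β < γ) (hγ : γ ≤ 1 / 2)
    (σ : W × W → U →L[ℝ] W) (hσ : IsCb 3 σ) :
    ∃ P : MvPolynomial (Fin 2) ℝ,
      ∀ (𝓧 : DelayedRoughPath N r γ) (ξ : ℝ → W) (ξ' : ℝ → U →L[ℝ] W),
        IsControlled 𝓧.path β (-r) 0 ξ ξ' →
        ∀ α : ℝ, 1 / 3 < α → α ≤ β →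
        ∀ (y : ℝ → W) (y' : ℝ → U →L[ℝ] W), IsSolution 𝓧 σ α ξ ξ' y y' →
          IsControlled 𝓧.path β 0 r y y' ∧
          controlledNorm 𝓧.path β 0 r y y' ≤
            MvPolynomial.eval
              ![1 + 𝓧.norm 0 r, controlledNorm 𝓧.path β (-r) 0 ξ ξ'] P := by
  obtain ⟨C, hC⟩ := exists_coefficientBound N hN hσ
  have hK := sewingConst_pos (show 1 < 3 * β by linarith)
  have hC0 : 0 ≤ C := (norm_nonneg _).trans (hC.norm_le 0)
  have hr' : 0 < r⁻¹ := inv_pos.2 hr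
  set L : ℝ := 2 + r + r⁻¹ + C + sewingConst (3 * β) with hL
  refine ⟨MvPolynomial.C 200000 * (MvPolynomial.C L *
    (MvPolynomial.X 0 * (1 + MvPolynomial.X 1)) ^ 2) ^ 28, ?_⟩
  intro 𝓧 ξ ξ' hξ α hα hαβ y y' hy
  simp only [map_mul, map_pow, map_add, map_one, MvPolynomial.eval_C, MvPolynomial.eval_X,
    Matrix.cons_val_zero, Matrix.cons_val_one]
  set R := controlledNorm 𝓧.path β (-r) 0 ξ ξ' with hR
  set T := L * ((1 + 𝓧.norm 0 r) * (1 + R)) ^ 2 with hT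
  have hR0 : 0 ≤ R := controlledNorm_nonneg _ _ _ _ _ _
  have h1a : 1 ≤ (1 + 𝓧.norm 0 r) * (1 + R) :=
    one_le_mul_of_one_le_of_one_le (by linarith [𝓧.norm_nonneg 0 r]) (by linarith)
  have hLT : L ≤ T := le_mul_of_one_le_right (by positivity) (one_le_pow₀ h1a)
  have hRT : R ≤ T := by
    have h1 : R ≤ (1 + 𝓧.norm 0 r) * (1 + R) := by nlinarith [𝓧.norm_nonneg 0 r]
    have h2 := le_self_pow₀ h1a two_ne_zero
    have h3 : ((1 + 𝓧.norm 0 r) * (1 + R)) ^ 2 ≤ T :=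
      le_mul_of_one_le_left (by positivity) (by linarith)
    linarith
  have hdata : ∀ {κ : ℝ}, 0 < κ → κ ≤ β → DataBound N 𝓧.path (fun s => 𝓧.path (s - r)) 𝓧.area
      𝓧.delayedArea (fun s => y (s - r)) (fun s => ξ' (s - r)) r κ T := fun h0 h1 =>
    hξ.dataBound hy.initial hr hβγ hγ h0 h1 (by linarith)
  have hCT : CoefficientBound N σ T := hC.mono (by linarith)
  have hsol := hy.isGermSolution.of_exponent_le hCT (hdata (by linarith) hαβ)
    (hdata (by linarith) le_rfl) (by linarith) hαβ (by linarith)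
  refine hsol.controlledNorm_le hCT (hdata (by linarith) le_rfl) (by linarith) (by linarith)
    (by linarith) hr (by linarith) (by linarith) (by simp) ?_
  rw [zero_sub, hy.initial (-r) ⟨le_rfl, by linarith⟩]
  refine le_trans ?_ hRT
  have s5 : 0 ≤ holderSeminorm β (Icc (-r) 0) (incr ξ') :=
    holderSeminorm_nonneg fun s t => norm_nonneg _
  have s6 : 0 ≤ holderSeminorm (2 * β) (Icc (-r) 0) (fun s t => ‖remainder 𝓧.path ξ ξ' s t‖) :=
    holderSeminorm_nonneg fun s t => norm_nonneg _
  rw [hR, controlledNorm]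
  linarith [norm_nonneg (ξ' (-r))]
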